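/- **Setting.** Let $\mathcal X$ be an infinite-dimensional separable real Hilbert space. Let $\mathcal C_0$ be a self-adjoint, positive-definite, trace class operator on $\mathcal X$ with orthonormal eigenbasis $\{\phi_k\}$ and eigenvalues $\lambda_k^2$; let $\mathcal C_1$ be a bounded, self-adjoint, positive-definite (not necessarily trace class) operator on $\mathcal X$; and let $\mathcal A\colon\mathcal D(\mathcal A)\subset\mathcal X\to\mathcal X$ be self-adjoint and positive-definite with bounded inverse. For $t\in\mathbb R$ let $X^t$ be the Hilbert scale of $\mathcal C_0$, with norm $\|u\|_t=\|\mathcal C_0^{-t/2}u\|=\big(\sum_k\lambda_k^{-2t}u_k^2\big)^{1/2}$, $u_k=\langle u,\phi_k\rangle$; its elements are identified with their coefficient sequences. Below, an operator composed of $\mathcal C_1^{\pm1/2},\mathcal C_1^{-1},\mathcal A^{-1}$ that is classically defined only on a subspace of $X^t$ is understood to be defined on a dense subspace and extended to $X^t$ by continuity. **Assumptions.** There are $s_0\in[0,1)$, $\beta,\ell\ge0$ and constants $c,c',c_1,\dots,c_4>0$ such that, with $\Delta:=2\ell-\beta+1$: 1. $\mathcal C_0^s$ is trace class for all $s>s_0$;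 2. $\Delta>2s_0$; 3. $c\,\|u\|_{\beta-2\ell}\le\|\mathcal C_1^{-1/2}\mathcal A^{-1}u\|\le c'\|u\|_{\beta-2\ell}$ for all $u\in X^{\beta-2\ell}$; in particular $\mathcal A^{-1}u\in\mathcal D(\mathcal C_1^{-1/2})$ for $u\in\mathcal X\cap X^{\beta-2\ell}$; 4. $\|\mathcal C_1^{1/2}u\|_\rho\le c_1\|u\|_{\rho-\beta}$ for all $u\in X^{\rho-\beta}$, $\rho\in[\lceil\beta-s_0-1\rceil,\beta-s_0)$; 5. $\|\mathcal C_1^{-1/2}u\|_{-s}\le c_2\|u\|_{\beta-s}$ for all $u\in X^{\beta-s}$, $s\in(s_0,1]$; 6. $\|\mathcal C_1^{-1/2}\mathcal A^{-1}u\|_{s}\le c_3\|u\|_{s+\beta-2\ell}$ for all $u\in X^{s+\beta-2\ell}$, $s\in(s_0,1]$; 7. $\|\mathcal A^{-1}\mathcal C_1^{-1}u\|_{-\eta}\le c_4\|u\|_{2\beta-2\ell-\eta}$ for all $u\in X^{2\beta-2\ell-\eta}$, $\eta\in[\beta-2\ell,1]$. **Data and posterior mean.** Let $u^\dagger\in\mathcal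 X$, and for $n\ge1$ let $y^\dagger=\mathcal A^{-1}u^\dagger+n^{-1/2}\xi$ with $\xi\sim\mathcal N(0,\mathcal C_1)$, that is, $\xi$ is a random coefficient sequence such that $\sum_k a_k\xi_k\sim\mathcal N(0,\langle\mathcal C_1v,v\rangle)$ for each finite combination $v=\sum_k a_k\phi_k$. For a prior scaling $\tau>0$ (prior $\mathcal N(0,\tau^2\mathcal C_0)$) put $\lambda=\frac1{n\tau^2}$. The posterior mean $m_\lambda^\dagger\in X^1$ is the weak solution of $(\mathcal A^{-1}\mathcal C_1^{-1}\mathcal A^{-1}+\lambda\mathcal C_0^{-1})m_\lambda^\dagger=\mathcal A^{-1}\mathcal C_1^{-1}y^\dagger$, i.e. $$\langle\mathcal C_1^{-1/2}\mathcal A^{-1}m_\lambda^\dagger,\mathcal C_1^{-1/2}\mathcal A^{-1}v\rangle+\lambda\langle\mathcal C_0^{-1/2}m_\lambda^\dagger,\mathcal C_0^{-1/2}v\rangle=\langle\mathcal A^{-1}\mathcal C_1^{-1}y^\dagger,v\rangle\qquad\forall v\in X^1,$$ where $\mathcal A^{-1}\mathcal C_1^{-1}$ is extended by continuity to an operator $X^{2\beta-2\ell-1}\to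 X^{-1}$. **Theorem.** Under these assumptions let $u^\dagger\in X^\gamma$ with $\gamma\ge1$, let $\theta\in[0,1]$, $\eta=(1-\theta)(\beta-2\ell)+\theta$, and let $\varepsilon>0$. For each choice of $\tau(n)$ below and every $n\ge1$, the posterior mean $m_\lambda^\dagger$ almost surely exists, is unique, and is a random variable, and there is a constant $c>0$ independent of $n\ge1$ such that: i) if $\gamma\in(1,\Delta+1]$ and $\tau(n)=n^{-\frac{\gamma-1+s_0+\varepsilon}{2(\Delta+\gamma-1+s_0+\varepsilon)}}$, then $\mathbb E\|m_\lambda^\dagger-u^\dagger\|_\eta^2\le c\,n^{-\frac{\Delta+\gamma-1-\theta\Delta}{\Delta+\gamma-1+s_0+\varepsilon}}$; ii) if $\gamma>\Delta+1$ and $\tau(n)=n^{-\frac{\Delta+s_0+\varepsilon}{2(2\Delta+s_0+\varepsilon)}}$, then $\mathbb E\|m_\lambda^\dagger-u^\dagger\|_\eta^2\le c\,n^{-\frac{(2-\theta)\Delta}{2\Delta+s_0+\varepsilon}}$; iii) if $\gamma=1$, $\theta\in[0,1)$ and $\tau(n)=n^{-\frac{s_0+\varepsilon}{2(\Delta+s_0+\varepsilon)}}$,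 then $\mathbb E\|m_\lambda^\dagger-u^\dagger\|_\eta^2\le c\,n^{-\frac{(1-\theta)\Delta}{\Delta+s_0+\varepsilon}}$. -/

import Mathlib

open MeasureTheory ProbabilityTheory Filter Topology Set
open scoped ENNReal NNReal InnerProductSpace

noncomputable section

/-- The operators of the linear inverse problem `y = A⁻¹ u + n^{-1/2} ξ` on an infinite-dimensional
separable real Hilbert space `X`, with prior `N(0, τ² C₀)` and noise `ξ ∼ N(0, C₁)`. -/
structure InverseProblem (X : Type*) [NormedAddCommGroup X] [InnerProductSpace ℝ X]
    [CompleteSpace X] where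
  /-- The prior covariance operator. -/
  C₀ : X →L[ℝ] X
  /-- An orthonormal basis of eigenvectors of `C₀`. -/
  φ : HilbertBasis ℕ ℝ X
  /-- The square roots `λ_k` of the eigenvalues of `C₀`. -/
  lam : ℕ → ℝ
  /-- `C₀` is positive definite. -/
  lam_pos : ∀ k, 0 < lam k
  /-- The eigenvalue relation; in particular `C₀` is self-adjoint. -/
  C₀_apply : ∀ k, C₀ (φ k) = (lam k ^ 2) • φ k
  /-- `C₀` is trace class. -/
  C₀_trace : Summable fun k => lam k ^ 2
  /-- The noise covariance operator, bounded but not necessarily trace class. -/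
  C₁ : X →L[ℝ] X
  C₁_selfAdjoint : IsSelfAdjoint C₁
  C₁_posDef : ∀ x, x ≠ 0 → 0 < ⟪C₁ x, x⟫_ℝ
  /-- The (unique) positive square root of `C₁`. -/
  sqrtC₁ : X →L[ℝ] X
  sqrtC₁_pos : sqrtC₁.IsPositive
  sqrtC₁_sq : sqrtC₁ ∘L sqrtC₁ = C₁
  /-- The operator `A`, unbounded in general. -/
  A : X →ₗ.[ℝ] X
  A_dense : Dense (A.domain : Set X)
  A_selfAdjoint : IsSelfAdjoint A
  A_posDef : ∀ u : A.domain, (u : X) ≠ 0 → 0 < ⟪A u, (u : X)⟫_ℝ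
  /-- The bounded inverse of `A`. -/
  Ainv : X →L[ℝ] X
  Ainv_mem : ∀ x, Ainv x ∈ A.domain
  A_Ainv : ∀ x, A ⟨Ainv x, Ainv_mem x⟩ = x
  Ainv_A : ∀ u : A.domain, Ainv (A u) = u

namespace InverseProblem

variable {X : Type*} [NormedAddCommGroup X] [InnerProductSpace ℝ X] [CompleteSpace X]
variable (M : InverseProblem X)

/-- The coefficients of a vector in the eigenbasis of `C₀`. -/
def coef (u : X) : ℕ → ℝ := fun k => ⟪M.φ k, u⟫_ℝ

/-- The norm `‖a‖_t = ‖C₀^{-t/2} a‖` of the Hilbert scale, for an element given by its coefficients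
in the eigenbasis of `C₀` (where `C₀^{-t/2} φ_k = λ_k^{-t} φ_k`); it is `∞` outside `X^t`. Elements
of `X^t` with `t < 0` need not be vectors of `X`, so they are represented by their coefficients. -/
def scaleNorm (t : ℝ) (a : ℕ → ℝ) : ℝ≥0∞ :=
  (∑' k, ENNReal.ofReal (M.lam k ^ (-2 * t) * a k ^ 2)) ^ (1 / 2 : ℝ)

/-- Membership in `X^t`, the completion of `⋂_l D(C₀^{-l})` in `‖·‖_t`. -/
def MemScale (t : ℝ) (a : ℕ → ℝ) : Prop := M.scaleNorm t a < ∞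

/-- The operator `C₁^{-1/2}`; the value is meaningful on its domain, the range of `C₁^{1/2}`. -/
def invSqrtC₁ (x : X) : X := Function.invFun M.sqrtC₁ x

/-- The operator `Q P⁻¹`, with domain the range of `P`, acts as a bounded operator from `X^t`
to `X^r` with constant `c`: its domain meets `X^t` in a dense subspace, and the bound
`‖Q P⁻¹ u‖_r ≤ c ‖u‖_t` holds there, so that it extends to all `u ∈ X^t` by continuity. -/
def ExtendsBounded (P Q : X →L[ℝ] X) (t r : ℝ) (c : ℝ≥0) : Prop :=
  (∀ a : ℕ → ℝ, M.MemScale t a → ∀ δ : ℝ≥0∞, 0 < δ →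
    ∃ x : X, M.scaleNorm t (M.coef (P x) - a) < δ) ∧
  ∀ x : X, M.scaleNorm r (M.coef (Q x)) ≤ c * M.scaleNorm t (M.coef (P x))

/-- The standing assumptions relating `C₀`, `C₁` and `A⁻¹`, with `Δ = 2ℓ - β + 1`. -/
structure Assumptions (s₀ β ℓ : ℝ) : Prop where
  s₀_nonneg : 0 ≤ s₀
  s₀_lt_one : s₀ < 1
  β_nonneg : 0 ≤ β
  ℓ_nonneg : 0 ≤ ℓ
  /-- `C₀^s` is trace class for all `s > s₀`. -/
  trace : ∀ s, s₀ < s → Summable fun k => M.lam k ^ (2 * s)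
  /-- `Δ > 2 s₀`. -/
  illposed : 2 * s₀ < 2 * ℓ - β + 1
  /-- `‖C₁^{-1/2} A⁻¹ u‖ ≍ ‖C₀^{ℓ-β/2} u‖` on `X^{β-2ℓ}` (it suffices to say this for the elements
  that are vectors of `X`, since these are dense). -/
  forward : ∃ c c' : ℝ≥0, 0 < c ∧ 0 < c' ∧ ∀ u : X, M.MemScale (β - 2 * ℓ) (M.coef u) →
    M.Ainv u ∈ range M.sqrtC₁ ∧
    c * M.scaleNorm (β - 2 * ℓ) (M.coef u) ≤ ‖M.invSqrtC₁ (M.Ainv u)‖ₑ ∧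
    ‖M.invSqrtC₁ (M.Ainv u)‖ₑ ≤ c' * M.scaleNorm (β - 2 * ℓ) (M.coef u)
  /-- `‖C₀^{-ρ/2} C₁^{1/2} u‖ ≤ c₁ ‖C₀^{(β-ρ)/2} u‖` on `X^{ρ-β}`. -/
  noise : ∃ c₁ : ℝ≥0, 0 < c₁ ∧ ∀ ρ ∈ Ico (⌈β - s₀ - 1⌉ : ℝ) (β - s₀),
    M.ExtendsBounded (ContinuousLinearMap.id ℝ X) M.sqrtC₁ (ρ - β) ρ c₁
  /-- `‖C₀^{s/2} C₁^{-1/2} u‖ ≤ c₂ ‖C₀^{(s-β)/2} u‖` on `X^{β-s}`. -/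
  noise_inv : ∃ c₂ : ℝ≥0, 0 < c₂ ∧ ∀ s ∈ Ioc s₀ 1,
    M.ExtendsBounded M.sqrtC₁ (ContinuousLinearMap.id ℝ X) (β - s) (-s) c₂
  /-- `‖C₀^{-s/2} C₁^{-1/2} A⁻¹ u‖ ≤ c₃ ‖C₀^{(2ℓ-β-s)/2} u‖` on `X^{s+β-2ℓ}` (again stated on the
  dense subspace of vectors of `X`). -/
  forward_reg : ∃ c₃ : ℝ≥0, 0 < c₃ ∧ ∀ s ∈ Ioc s₀ 1, ∀ u : X,
    M.MemScale (s + β - 2 * ℓ) (M.coef u) →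
    M.Ainv u ∈ range M.sqrtC₁ ∧
    M.scaleNorm s (M.coef (M.invSqrtC₁ (M.Ainv u))) ≤
      c₃ * M.scaleNorm (s + β - 2 * ℓ) (M.coef u)
  /-- `‖C₀^{η/2} A⁻¹ C₁⁻¹ u‖ ≤ c₄ ‖C₀^{η/2+ℓ-β} u‖` on `X^{2β-2ℓ-η}`. -/
  data : ∃ c₄ : ℝ≥0, 0 < c₄ ∧ ∀ η ∈ Icc (β - 2 * ℓ) 1,
    M.ExtendsBounded M.C₁ M.Ainv (2 * β - 2 * ℓ - η) (-η) c₄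

/-- `ξ ∼ N(0, C₁)`, as a random sequence of coefficients in the eigenbasis of `C₀` (`ξ` need not take
values in `X`): for every finite combination `v = ∑ a_k φ_k` the variable `∑ a_k ξ_k`, which stands
for `⟨ξ, v⟩`, has law `N(0, ⟨C₁ v, v⟩)`. -/
def IsNoise {Ω : Type*} [MeasurableSpace Ω] (P : Measure Ω) (ξ : Ω → ℕ → ℝ) : Prop :=
  ∀ a : ℕ →₀ ℝ,
    HasLaw (fun ω => a.sum fun k c => c * ξ ω k)
      (gaussianReal 0 (⟪M.C₁ (a.sum fun k c => c • M.φ k), a.sum fun k c => c • M.φ k⟫_ℝ).toNNReal)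
      P

/-- The data `y† = A⁻¹ u† + n^{-1/2} ξ`, in coefficients. -/
def data (u : X) (n : ℝ) (ξ : ℕ → ℝ) : ℕ → ℝ :=
  fun k => M.coef (M.Ainv u) k + (Real.sqrt n)⁻¹ * ξ k

/-- The bilinear form
`B(w,v) = ⟨C₁^{-1/2} A⁻¹ w, C₁^{-1/2} A⁻¹ v⟩ + Λ ⟨C₀^{-1/2} w, C₀^{-1/2} v⟩` on `X^1`. -/
def form (Λ : ℝ) (w v : X) : ℝ :=
  ⟪M.invSqrtC₁ (M.Ainv w), M.invSqrtC₁ (M.Ainv v)⟫_ℝ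
    + Λ * ∑' k, M.lam k ^ (-2 : ℝ) * (M.coef w k * M.coef v k)

/-- `w ∈ X^1` is a weak solution of `(A⁻¹ C₁⁻¹ A⁻¹ + Λ C₀⁻¹) w = r`, where `r ∈ X^{-1}`. -/
def IsWeakSolution (Λ : ℝ) (r : ℕ → ℝ) (w : X) : Prop :=
  M.MemScale (-1) r ∧ M.MemScale 1 (M.coef w) ∧
  ∀ v : X, M.MemScale 1 (M.coef v) → M.form Λ w v = ∑' k, r k * M.coef v k

/-- `r = A⁻¹ C₁⁻¹ y`, where `A⁻¹ C₁⁻¹` is extended by continuity to a map from `X^{2β-2ℓ-1}` to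
`X^{-1}`. -/
def IsAinvC₁inv (β ℓ : ℝ) (y r : ℕ → ℝ) : Prop :=
  M.MemScale (2 * β - 2 * ℓ - 1) y ∧ M.MemScale (-1) r ∧ ∃ x : ℕ → X,
    Tendsto (fun j => M.scaleNorm (2 * β - 2 * ℓ - 1) (M.coef (M.C₁ (x j)) - y)) atTop (𝓝 0) ∧
    Tendsto (fun j => M.scaleNorm (-1) (M.coef (M.Ainv (x j)) - r)) atTop (𝓝 0)

/-- `w` is a posterior mean for the data `y` and `Λ = 1/(n τ²)`: a weak solution of
`(A⁻¹ C₁⁻¹ A⁻¹ + Λ C₀⁻¹) w = A⁻¹ C₁⁻¹ y`. -/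
def IsPosteriorMean (β ℓ Λ : ℝ) (y : ℕ → ℝ) (w : X) : Prop :=
  ∃ r, M.IsAinvC₁inv β ℓ y r ∧ M.IsWeakSolution Λ r w

/-- The posterior mean (meaningful for those data `y` for which it exists and is unique). -/
def posteriorMean (β ℓ Λ : ℝ) (y : ℕ → ℝ) : X :=
  Classical.epsilon fun w => M.IsPosteriorMean β ℓ Λ y w

/-- With the prior scaling `τ = τ(n)` and `Λ = 1/(n τ²)`, the posterior mean `m` for the data `y†` is
almost surely well defined, it is a random variable, and `E ‖m - u†‖_η² ≤ c · rate(n)` with a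
constant `c` independent of `n ≥ 1`. -/
def MeanErrorRate (β ℓ : ℝ) {Ω : Type*} [MeasurableSpace Ω] (P : Measure Ω) (ξ : Ω → ℕ → ℝ)
    (u : X) (η : ℝ) (τ rate : ℝ → ℝ) : Prop :=
  ∃ c : ℝ, 0 < c ∧ ∀ n : ℝ, 1 ≤ n →
    (∀ᵐ ω ∂P, ∃! w : X, M.IsPosteriorMean β ℓ (1 / (n * τ n ^ 2)) (M.data u n (ξ ω)) w) ∧
    AEStronglyMeasurable
      (fun ω => M.posteriorMean β ℓ (1 / (n * τ n ^ 2)) (M.data u n (ξ ω))) P ∧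
    ∫⁻ ω, M.scaleNorm η
      (M.coef (M.posteriorMean β ℓ (1 / (n * τ n ^ 2)) (M.data u n (ξ ω)) - u)) ^ 2 ∂P
      ≤ ENNReal.ofReal (c * rate n)

end InverseProblem

end

/-!
By the weak formulation the error `e = m - u†` satisfies, for all `v ∈ X^1`,
`form Λ e v = ⟨A⁻¹ C₁⁻¹ (y† - A⁻¹ u†), v⟩ - Λ ⟨C₀⁻¹ u†, v⟩`.
Take `v = e`. The energy norm `form Λ e e ^ (1/2)` dominates `‖e‖_{β-2ℓ}` and `Λ^{1/2} ‖e‖_1`,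
hence by interpolation `Λ^{a/2} ‖e‖_{β-2ℓ+aΔ}` for `a ∈ [0, 1]`. Pairing the noise in `X^{β-s}` with
`e` in `X^{s+β-2ℓ}`, and `C₀⁻¹ u†` in `X^{γ-2}` with `e` in `X^{2-γ}`, gives
`E ‖e‖_η² ≲ Λ^{-(θ+s/Δ)} / n + Λ^{1-θ+(γ-1)/Δ}`,
where `s > s₀` makes the second moment of the noise in `X^{β-s}` finite. The choice of `τ` means
`Λ = n^{-Δ/(Δ+γ-1+s₀+ε)}`, which balances the two terms. For `γ > Δ + 1` the exponent `2 - γ` drops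
below `β - 2ℓ`, where the energy norm gives no further gain, so the rate is that of `γ = Δ + 1`.
-/

lemma norm_le_mul_norm_of_enorm_le {E F : Type*} [SeminormedAddCommGroup E]
    [SeminormedAddCommGroup F] {C : ℝ≥0} {x : E} {y : F} (h : ‖x‖ₑ ≤ C * ‖y‖ₑ) :
    ‖x‖ ≤ C * ‖y‖ := by
  simp only [enorm_eq_nnnorm] at h
  exact_mod_cast h

lemma exists_clm_comp_eq_of_range_subset {𝕜 E F G : Type*} [NontriviallyNormedField 𝕜]
    [NormedAddCommGroup E] [NormedSpace 𝕜 E] [CompleteSpace E]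
    [NormedAddCommGroup F] [NormedSpace 𝕜 F] [CompleteSpace F]
    [AddCommGroup G] [Module 𝕜 G] [TopologicalSpace G] [T2Space G]
    {f : F →L[𝕜] G} (hf : Function.Injective f) {g : E →L[𝕜] G} (h : range g ⊆ range f) :
    ∃ T : E →L[𝕜] F, ∀ x, f (T x) = g x := by
  choose T hT using fun x => h (mem_range_self x)
  let S : E →ₗ[𝕜] F :=
    { toFun := T
      map_add' := fun x y => hf (by simp only [map_add, hT])
      map_smul' := fun c x => hf (by simp only [map_smul, hT, RingHom.id_apply]) }
  have h_graph : (S.graph : Set (E × F)) = {p | f p.2 = g p.1} := by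
    ext ⟨x, y⟩
    simpa [LinearMap.mem_graph_iff, S, ← hT] using hf.eq_iff.symm
  refine ⟨.ofIsClosedGraph (g := S) ?_, hT⟩
  rw [h_graph]
  exact isClosed_eq (by fun_prop) (by fun_prop)

lemma exists_clm_of_linearRelation {𝕜 E F : Type*} [NontriviallyNormedField 𝕜]
    [NormedAddCommGroup E] [NormedSpace 𝕜 E] [NormedAddCommGroup F] [NormedSpace 𝕜 F]
    [CompleteSpace F] (V : Submodule 𝕜 (E × F)) (h_dense : Dense (Prod.fst '' (V : Set (E × F))))
    {C : ℝ} (h_bound : ∀ p ∈ V, ‖p.2‖ ≤ C * ‖p.1‖) : ∃ T : E →L[𝕜] F, ∀ p ∈ V, T p.1 = p.2 := by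
  let e : V →ₗ[𝕜] E := .fst 𝕜 E F ∘ₗ V.subtype
  let f : V →ₗ[𝕜] F := .snd 𝕜 E F ∘ₗ V.subtype
  refine ⟨f.extendOfNorm e, fun p hp =>
    LinearMap.extendOfNorm_eq (e := e) ?_ ⟨C, fun p => h_bound p p.2⟩ ⟨p, hp⟩⟩
  rwa [DenseRange, show range e = Prod.fst '' (V : Set (E × F)) by ext; simp [e]]

namespace InverseProblem

variable {X : Type*} [NormedAddCommGroup X] [InnerProductSpace ℝ X] [CompleteSpace X]
variable (M : InverseProblem X)

/-! ### The Hilbert scale -/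

lemma lam_rpow_pos (k : ℕ) (t : ℝ) : 0 < M.lam k ^ t := Real.rpow_pos_of_pos (M.lam_pos k) t

lemma lam_rpow_neg_mul (k : ℕ) (t : ℝ) : M.lam k ^ (-t) * M.lam k ^ t = 1 := by
  rw [← Real.rpow_add (M.lam_pos k), neg_add_cancel, Real.rpow_zero]

lemma exists_lam_le : ∃ C : ℝ, ∀ k, M.lam k ≤ C := by
  obtain ⟨C, hC⟩ := M.C₀_trace.tendsto_atTop_zero.bddAbove_range
  exact ⟨√C, fun k => Real.le_sqrt_of_sq_le (hC ⟨k, rfl⟩)⟩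

lemma scaleNorm_sq (t : ℝ) (a : ℕ → ℝ) :
    M.scaleNorm t a ^ 2 = ∑' k, ENNReal.ofReal (M.lam k ^ (-2 * t) * a k ^ 2) := by
  rw [scaleNorm, ← ENNReal.rpow_natCast, ← ENNReal.rpow_mul]
  norm_num

lemma weight_mul_sq (t x : ℝ) (k : ℕ) :
    M.lam k ^ (-2 * t) * x ^ 2 = (M.lam k ^ (-t) * x) ^ 2 := by
  rw [mul_pow, ← Real.rpow_mul_natCast (M.lam_pos k).le]
  congr 2
  push_cast
  ring

lemma scaleNorm_eq_eLpNorm (t : ℝ) (a : ℕ → ℝ) :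
    M.scaleNorm t a = eLpNorm (fun k => M.lam k ^ (-t) * a k) 2 Measure.count := by
  rw [eLpNorm_eq_lintegral_rpow_enorm_toReal two_ne_zero ENNReal.ofNat_ne_top, lintegral_count,
    scaleNorm, ENNReal.toReal_ofNat]
  congr 2 with k
  rw [ENNReal.rpow_two, ← ofReal_norm, ← ENNReal.ofReal_pow (norm_nonneg _), Real.norm_eq_abs,
    sq_abs, weight_mul_sq]

lemma scaleNorm_add_le (t : ℝ) (a b : ℕ → ℝ) :
    M.scaleNorm t (a + b) ≤ M.scaleNorm t a + M.scaleNorm t b := by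
  simp only [scaleNorm_eq_eLpNorm, Pi.add_apply, mul_add]
  exact eLpNorm_add_le .of_discrete .of_discrete one_le_two

lemma scaleNorm_sub_le (t : ℝ) (a b c : ℕ → ℝ) :
    M.scaleNorm t (a - c) ≤ M.scaleNorm t (a - b) + M.scaleNorm t (b - c) := by
  simpa using M.scaleNorm_add_le t (a - b) (b - c)

lemma scaleNorm_smul (t c : ℝ) (a : ℕ → ℝ) : M.scaleNorm t (c • a) = ‖c‖ₑ * M.scaleNorm t a := by
  simp only [scaleNorm_eq_eLpNorm, Pi.smul_apply, smul_eq_mul, mul_left_comm _ c]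
  exact eLpNorm_const_smul c _ _ _

lemma exists_scaleNorm_le {t t' : ℝ} (h : t ≤ t') :
    ∃ C : ℝ≥0, ∀ a, M.scaleNorm t a ≤ C * M.scaleNorm t' a := by
  obtain ⟨C, hC⟩ := M.exists_lam_le
  refine ⟨(C ^ (t' - t)).toNNReal, fun a => ?_⟩
  simp only [scaleNorm_eq_eLpNorm]
  refine eLpNorm_le_nnreal_smul_eLpNorm_of_ae_le_mul (.of_forall fun k => ?_) 2
  have h_split : M.lam k ^ (-t) = M.lam k ^ (t' - t) * M.lam k ^ (-t') := by
    rw [← Real.rpow_add (M.lam_pos k)]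
    congr 1
    ring
  rw [h_split, mul_assoc, nnnorm_mul]
  gcongr
  rw [← norm_toNNReal, Real.norm_of_nonneg (M.lam_rpow_pos k _).le]
  exact Real.toNNReal_le_toNNReal
    (Real.rpow_le_rpow (M.lam_pos k).le (hC k) (sub_nonneg.2 h))

lemma enorm_tsum_mul_le (t : ℝ) (a b : ℕ → ℝ) :
    ‖∑' k, a k * b k‖ₑ ≤ M.scaleNorm (-t) a * M.scaleNorm t b := by
  have h_weight : (fun k => a k * b k)
      = (fun k => M.lam k ^ (- -t) * a k) • fun k => M.lam k ^ (-t) * b k := by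
    ext k
    simp only [Pi.smul_apply', smul_eq_mul]
    linear_combination (-(a k * b k)) * M.lam_rpow_neg_mul k (-t)
  calc ‖∑' k, a k * b k‖ₑ ≤ ∑' k, ‖a k * b k‖ₑ := enorm_tsum_le_tsum_enorm
    _ = eLpNorm (fun k => a k * b k) 1 Measure.count := by
      rw [eLpNorm_one_eq_lintegral_enorm, lintegral_count]
    _ ≤ M.scaleNorm (-t) a * M.scaleNorm t b := by
      rw [h_weight, scaleNorm_eq_eLpNorm, scaleNorm_eq_eLpNorm]
      exact eLpNorm_smul_le_mul_eLpNorm .of_discrete .of_discrete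

lemma scaleNorm_interpolation (p q : ℝ) {θ : ℝ} (hθ : θ ∈ Icc 0 1) (a : ℕ → ℝ) :
    M.scaleNorm ((1 - θ) * p + θ * q) a ≤ M.scaleNorm p a ^ (1 - θ) * M.scaleNorm q a ^ θ := by
  have hθ' : 0 ≤ 1 - θ := sub_nonneg.2 hθ.2
  let f (t : ℝ) (k : ℕ) : ℝ≥0∞ := ENNReal.ofReal (M.lam k ^ (-2 * t) * a k ^ 2)
  have h_term : ∀ k, f ((1 - θ) * p + θ * q) k = f p k ^ (1 - θ) * f q k ^ θ := fun k => by
    have hp := M.lam_rpow_pos k (-2 * p)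
    have hq := M.lam_rpow_pos k (-2 * q)
    simp only [f]
    rw [ENNReal.ofReal_rpow_of_nonneg (by positivity) hθ',
      ENNReal.ofReal_rpow_of_nonneg (by positivity) hθ.1, ← ENNReal.ofReal_mul (by positivity),
      Real.mul_rpow hp.le (sq_nonneg _), Real.mul_rpow hq.le (sq_nonneg _), mul_mul_mul_comm,
      ← Real.rpow_mul (M.lam_pos k).le, ← Real.rpow_mul (M.lam_pos k).le,
      ← Real.rpow_add (M.lam_pos k), ← Real.rpow_add_of_nonneg (sq_nonneg _) hθ' hθ.1,
      sub_add_cancel, Real.rpow_one]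
    congr 3
    ring
  have h_holder : ∑' k, f ((1 - θ) * p + θ * q) k ≤
      (∑' k, f p k) ^ (1 - θ) * (∑' k, f q k) ^ θ := by
    simpa only [lintegral_count, ← h_term] using
      ENNReal.lintegral_mul_norm_pow_le (μ := Measure.count) (f := f p) (g := f q)
        .of_discrete .of_discrete hθ' hθ.1 (sub_add_cancel 1 θ)
  refine (ENNReal.rpow_le_rpow h_holder one_half_pos.le).trans_eq ?_
  rw [ENNReal.mul_rpow_of_nonneg _ _ one_half_pos.le, scaleNorm, scaleNorm]
  simp only [f, ← ENNReal.rpow_mul, mul_comm]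

/-- The map `C₀^{t/2}`, written in coefficients. It is a linear isometry of `X` onto `X^t`, through
which elements of `X^t` are represented by vectors of `X`. -/
noncomputable def toScale (t : ℝ) : X →ₗ[ℝ] ℕ → ℝ where
  toFun x k := M.lam k ^ t * M.coef x k
  map_add' x y := by
    ext k
    simp [coef, inner_add_right, mul_add]
  map_smul' c x := by
    ext k
    simp [coef, inner_smul_right, mul_left_comm]

lemma toScale_apply (t : ℝ) (x : X) (k : ℕ) : M.toScale t x k = M.lam k ^ t * M.coef x k := rfl

lemma toScale_zero (x : X) : M.toScale 0 x = M.coef x := by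
  ext k
  simp [toScale_apply]

lemma coef_sub (x y : X) : M.coef (x - y) = M.coef x - M.coef y := by
  simp only [← toScale_zero, map_sub]

lemma hasSum_coef_mul_coef (x y : X) :
    HasSum (fun k => M.coef x k * M.coef y k) ⟪x, y⟫_ℝ := by
  simpa only [coef, real_inner_comm x] using M.φ.hasSum_inner_mul_inner x y

lemma hasSum_toScale_mul_toScale (t : ℝ) (x y : X) :
    HasSum (fun k => M.toScale (-t) x k * M.toScale t y k) ⟪x, y⟫_ℝ := by
  convert M.hasSum_coef_mul_coef x y using 2 with k
  simp only [toScale_apply]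
  linear_combination M.coef x k * M.coef y k * M.lam_rpow_neg_mul k t

lemma scaleNorm_toScale (t : ℝ) (x : X) : M.scaleNorm t (M.toScale t x) = ‖x‖ₑ := by
  have h_sum := M.hasSum_coef_mul_coef x x
  have h_sq : M.scaleNorm t (M.toScale t x) ^ 2 = ‖x‖ₑ ^ 2 := by
    rw [← ofReal_norm, ← ENNReal.ofReal_pow (norm_nonneg x), ← real_inner_self_eq_norm_sq,
      ← h_sum.tsum_eq, ENNReal.ofReal_tsum_of_nonneg (fun k => mul_self_nonneg _) h_sum.summable,
      scaleNorm_sq]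
    refine tsum_congr fun k => ?_
    rw [weight_mul_sq, toScale_apply, ← mul_assoc, lam_rpow_neg_mul, one_mul, sq]
  exact (ENNReal.pow_right_strictMono two_ne_zero).injective h_sq

lemma toScale_injective (t : ℝ) : Function.Injective (M.toScale t) := by
  refine (injective_iff_map_eq_zero _).2 fun x hx => ?_
  rw [← enorm_eq_zero, ← M.scaleNorm_toScale t, hx]
  simp [scaleNorm]

lemma scaleNorm_toScale_sub (t : ℝ) (x y : X) :
    M.scaleNorm t (M.toScale t x - M.toScale t y) = ‖x - y‖ₑ := by
  rw [← map_sub, scaleNorm_toScale]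

lemma tendsto_scaleNorm_sub_toScale_iff {t : ℝ} {a : ℕ → ℕ → ℝ} {p : ℕ → X} {x : X}
    (h : ∀ᶠ j in atTop, M.toScale t (p j) = a j) :
    Tendsto (fun j => M.scaleNorm t (a j - M.toScale t x)) atTop (𝓝 0) ↔ Tendsto p atTop (𝓝 x) := by
  rw [tendsto_iff_edist_tendsto_0]
  refine tendsto_congr' ?_
  filter_upwards [h] with j hj
  rw [← hj, scaleNorm_toScale_sub, edist_eq_enorm_sub]

lemma memScale_toScale (t : ℝ) (x : X) : M.MemScale t (M.toScale t x) := by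
  rw [MemScale, scaleNorm_toScale]
  exact enorm_lt_top

lemma memScale_iff_exists_toScale {t : ℝ} {a : ℕ → ℝ} :
    M.MemScale t a ↔ ∃ x, M.toScale t x = a := by
  refine ⟨fun h => ?_, fun ⟨x, hx⟩ => hx ▸ M.memScale_toScale t x⟩
  have h_mem : Memℓp (fun k => M.lam k ^ (-t) * a k) 2 := by
    have h_ne : ∑' k, ENNReal.ofReal (M.lam k ^ (-2 * t) * a k ^ 2) ≠ ∞ := by
      rw [← scaleNorm_sq]
      exact ENNReal.pow_ne_top h.ne
    refine (memℓp_gen_iff (by norm_num)).2 ((ENNReal.summable_toReal h_ne).congr fun k => ?_)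
    rw [weight_mul_sq, ENNReal.toReal_ofReal (sq_nonneg _), ENNReal.toReal_ofNat, Real.rpow_two,
      Real.norm_eq_abs, sq_abs]
  refine ⟨M.φ.repr.symm ⟨_, h_mem⟩, funext fun k => ?_⟩
  rw [toScale_apply, coef, ← HilbertBasis.repr_apply_apply, LinearIsometryEquiv.apply_symm_apply]
  linear_combination a k * M.lam_rpow_neg_mul k t

lemma exists_tendsto_of_tendsto_scaleNorm {t : ℝ} {a : ℕ → ℕ → ℝ} {x : X}
    (h : Tendsto (fun j => M.scaleNorm t (a j - M.toScale t x)) atTop (𝓝 0)) :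
    ∃ p : ℕ → X, Tendsto p atTop (𝓝 x) ∧ ∀ᶠ j in atTop, M.toScale t (p j) = a j := by
  have h_ex : ∀ j, ∃ p, M.scaleNorm t (a j - M.toScale t x) < ∞ → M.toScale t p = a j := fun j => by
    by_cases hj : M.scaleNorm t (a j - M.toScale t x) < ∞
    · obtain ⟨d, hd⟩ := M.memScale_iff_exists_toScale.1 hj
      exact ⟨x + d, fun _ => by rw [map_add, hd, add_sub_cancel]⟩
    · exact ⟨0, fun hj' => absurd hj' hj⟩
  choose p hp using h_ex
  have h_eq : ∀ᶠ j in atTop, M.toScale t (p j) = a j :=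
    (h.eventually_lt_const ENNReal.zero_lt_top).mono hp
  exact ⟨p, (M.tendsto_scaleNorm_sub_toScale_iff h_eq).1 h, h_eq⟩

variable {M}

lemma MemScale.mono {t t' : ℝ} (h : t ≤ t') {a : ℕ → ℝ} (ha : M.MemScale t' a) :
    M.MemScale t a := by
  obtain ⟨C, hC⟩ := M.exists_scaleNorm_le h
  exact (hC a).trans_lt (ENNReal.mul_lt_top ENNReal.coe_lt_top ha)

lemma MemScale.add {t : ℝ} {a b : ℕ → ℝ} (ha : M.MemScale t a) (hb : M.MemScale t b) :
    M.MemScale t (a + b) := by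
  obtain ⟨x, rfl⟩ := M.memScale_iff_exists_toScale.1 ha
  obtain ⟨y, rfl⟩ := M.memScale_iff_exists_toScale.1 hb
  exact map_add (M.toScale t) x y ▸ M.memScale_toScale t (x + y)

lemma MemScale.smul {t : ℝ} (c : ℝ) {a : ℕ → ℝ} (ha : M.MemScale t a) : M.MemScale t (c • a) := by
  obtain ⟨x, rfl⟩ := M.memScale_iff_exists_toScale.1 ha
  exact map_smul (M.toScale t) c x ▸ M.memScale_toScale t (c • x)

lemma MemScale.sub {t : ℝ} {a b : ℕ → ℝ} (ha : M.MemScale t a) (hb : M.MemScale t b) :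
    M.MemScale t (a - b) := by
  obtain ⟨x, rfl⟩ := M.memScale_iff_exists_toScale.1 ha
  obtain ⟨y, rfl⟩ := M.memScale_iff_exists_toScale.1 hb
  exact map_sub (M.toScale t) x y ▸ M.memScale_toScale t (x - y)

variable (M)

/-! ### The operators `C₀^{1/2}`, `C₁^{1/2}` and `C₁^{-1/2} A⁻¹` -/

lemma exists_clm_toScale_eq {t t' : ℝ} (h : t ≤ t') :
    ∃ J : X →L[ℝ] X, ∀ x, M.toScale t (J x) = M.toScale t' x := by
  obtain ⟨C, hC⟩ := M.exists_scaleNorm_le h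
  choose J hJ using fun x => M.memScale_iff_exists_toScale.1 ((M.memScale_toScale t' x).mono h)
  let S : X →ₗ[ℝ] X :=
    { toFun := J
      map_add' := fun x y => M.toScale_injective t (by simp only [map_add, hJ])
      map_smul' := fun c x => M.toScale_injective t (by
        simp only [map_smul, hJ, RingHom.id_apply]) }
  refine ⟨S.mkContinuous C fun x => norm_le_mul_norm_of_enorm_le ?_, hJ⟩
  rw [← M.scaleNorm_toScale t, ← M.scaleNorm_toScale t']
  exact (hJ x).symm ▸ hC _

/-- The operator `C₀^{1/2}`, seen as an isometry of `X` onto `X^1 ⊆ X`. -/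
noncomputable def sqrtC₀ : X →L[ℝ] X := (M.exists_clm_toScale_eq zero_le_one).choose

lemma coef_sqrtC₀ (x : X) : M.coef (M.sqrtC₀ x) = M.toScale 1 x := by
  rw [← toScale_zero]
  exact (M.exists_clm_toScale_eq zero_le_one).choose_spec x

lemma memScale_coef_sqrtC₀ (x : X) : M.MemScale 1 (M.coef (M.sqrtC₀ x)) := by
  rw [coef_sqrtC₀]
  exact M.memScale_toScale 1 x

lemma exists_sqrtC₀_eq {u : X} (hu : M.MemScale 1 (M.coef u)) : ∃ x, M.sqrtC₀ x = u := by
  obtain ⟨x, hx⟩ := M.memScale_iff_exists_toScale.1 hu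
  refine ⟨x, M.toScale_injective 0 ?_⟩
  rw [toScale_zero, toScale_zero, coef_sqrtC₀, hx]

lemma inner_Ainv_left (x y : X) : ⟪M.Ainv x, y⟫_ℝ = ⟪x, M.Ainv y⟫_ℝ := by
  have h := LinearPMap.adjoint_isFormalAdjoint M.A_dense
  rw [LinearPMap.isSelfAdjoint_def.1 M.A_selfAdjoint] at h
  simpa only [M.A_Ainv] using (h ⟨M.Ainv x, M.Ainv_mem x⟩ ⟨M.Ainv y, M.Ainv_mem y⟩).symm

lemma inner_sqrtC₁_left (x y : X) : ⟪M.sqrtC₁ x, y⟫_ℝ = ⟪x, M.sqrtC₁ y⟫_ℝ :=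
  M.sqrtC₁_pos.isSymmetric x y

lemma sqrtC₁_sqrtC₁ (x : X) : M.sqrtC₁ (M.sqrtC₁ x) = M.C₁ x :=
  DFunLike.congr_fun M.sqrtC₁_sq x

lemma inner_C₁_self (x : X) : ⟪M.C₁ x, x⟫_ℝ = ‖M.sqrtC₁ x‖ ^ 2 := by
  rw [← sqrtC₁_sqrtC₁, inner_sqrtC₁_left, real_inner_self_eq_norm_sq]

lemma sqrtC₁_injective : Function.Injective M.sqrtC₁ := by
  refine (injective_iff_map_eq_zero M.sqrtC₁).2 fun x hx => ?_
  by_contra h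
  have h_pos := M.C₁_posDef x h
  simp [inner_C₁_self, hx] at h_pos

/-- The operator `C₁^{-1/2} A⁻¹`, the forward map of the problem with whitened noise. The value is
meaningful at those `u` for which `A⁻¹ u` lies in the range of `C₁^{1/2}`. -/
noncomputable def whitenedForward (u : X) : X := M.invSqrtC₁ (M.Ainv u)

lemma sqrtC₁_whitenedForward {u : X} (hu : M.Ainv u ∈ range M.sqrtC₁) :
    M.sqrtC₁ (M.whitenedForward u) = M.Ainv u :=
  Function.invFun_eq hu

lemma form_sqrtC₀ (Λ : ℝ) (x y : X) : M.form Λ (M.sqrtC₀ x) (M.sqrtC₀ y)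
    = ⟪M.whitenedForward (M.sqrtC₀ x), M.whitenedForward (M.sqrtC₀ y)⟫_ℝ + Λ * ⟪x, y⟫_ℝ := by
  rw [form, ← (M.hasSum_coef_mul_coef x y).tsum_eq]
  congr 3 with k
  have h_weight : M.lam k ^ (-2 : ℝ) * M.lam k ^ (1 : ℝ) * M.lam k ^ (1 : ℝ) = 1 := by
    rw [← Real.rpow_add (M.lam_pos k), ← Real.rpow_add (M.lam_pos k)]
    norm_num
  simp only [coef_sqrtC₀, toScale_apply]
  linear_combination M.coef x k * M.coef y k * h_weight

variable {M}

lemma exists_clm_isWeakSolution_iff {T : X →L[ℝ] X}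
    (hT : ∀ x, T x = M.whitenedForward (M.sqrtC₀ x)) {Λ : ℝ} (hΛ : 0 < Λ) :
    ∃ R : X →L[ℝ] X, ∀ g w, M.IsWeakSolution Λ (M.toScale (-1) g) w ↔ w = M.sqrtC₀ (R g) := by
  let B : X →L[ℝ] X := T.adjoint ∘L T + algebraMap ℝ (X →L[ℝ] X) Λ
  have h_form : ∀ x y, M.form Λ (M.sqrtC₀ x) (M.sqrtC₀ y) = ⟪B x, y⟫_ℝ := fun x y => by
    rw [form_sqrtC₀, ← hT, ← hT, ← ContinuousLinearMap.adjoint_inner_left]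
    simp [B, inner_add_left, Algebra.algebraMap_eq_smul_one, inner_smul_left]
  have h_unit : IsUnit B := by
    refine B.isUnit_of_forall_le_norm_inner_map (c := ⟨Λ, hΛ.le⟩) hΛ fun x => ?_
    refine le_trans ?_ (Real.le_norm_self _)
    rw [← h_form, form_sqrtC₀, real_inner_self_eq_norm_sq, real_inner_self_eq_norm_sq, mul_comm]
    exact le_add_of_nonneg_left (sq_nonneg _)
  obtain ⟨R, hR⟩ := h_unit.exists_right_inv
  have hR' : ∀ x, B (R x) = x := fun x => DFunLike.congr_fun hR x
  have h_inj : Function.Injective B := (ContinuousLinearMap.isUnit_iff_bijective.1 h_unit).1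
  refine ⟨R, fun g w => ⟨fun ⟨_, hw, h⟩ => ?_, ?_⟩⟩
  · obtain ⟨x, rfl⟩ := M.exists_sqrtC₀_eq hw
    refine congrArg M.sqrtC₀ (h_inj (ext_inner_right ℝ fun y => ?_))
    rw [hR', ← h_form, h _ (M.memScale_coef_sqrtC₀ y), coef_sqrtC₀,
      (M.hasSum_toScale_mul_toScale 1 g y).tsum_eq]
  · rintro rfl
    refine ⟨M.memScale_toScale _ _, M.memScale_coef_sqrtC₀ _, fun v hv => ?_⟩
    obtain ⟨y, rfl⟩ := M.exists_sqrtC₀_eq hv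
    rw [h_form, hR', coef_sqrtC₀, (M.hasSum_toScale_mul_toScale 1 g y).tsum_eq]

/-! ### The posterior mean as a bounded operator -/

section Extension

variable {P Q : X →L[ℝ] X} {t r : ℝ} {c : ℝ≥0}

lemma ExtendsBounded.exists_tendsto (h : M.ExtendsBounded P Q t r c) {a : ℕ → ℝ}
    (ha : M.MemScale t a) :
    ∃ z : ℕ → X, Tendsto (fun j => M.scaleNorm t (M.coef (P (z j)) - a)) atTop (𝓝 0) := by
  choose z hz using fun j : ℕ =>
    h.1 a ha (j : ℝ≥0∞)⁻¹ (ENNReal.inv_pos.2 (ENNReal.natCast_ne_top j))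
  exact ⟨z, tendsto_of_tendsto_of_tendsto_of_le_of_le tendsto_const_nhds
    ENNReal.tendsto_inv_nat_nhds_zero (fun _ => zero_le) fun j => (hz j).le⟩

lemma ExtendsBounded.memScale (h : M.ExtendsBounded P Q t r c) {z : X}
    (hz : M.MemScale t (M.coef (P z))) : M.MemScale r (M.coef (Q z)) :=
  (h.2 z).trans_lt (ENNReal.mul_lt_top ENNReal.coe_lt_top hz)

lemma ExtendsBounded.exists_clm (h : M.ExtendsBounded P Q t r c) :
    ∃ L : X →L[ℝ] X, ∀ p z, M.toScale t p = M.coef (P z) → M.toScale r (L p) = M.coef (Q z) := by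
  -- `V` is the graph of `C₀^{-r/2} Q P⁻¹ C₀^{t/2}`.
  let V : Submodule ℝ (X × X) :=
    (LinearMap.range ((M.toScale 0 ∘ₗ P.toLinearMap).prod (M.toScale 0 ∘ₗ Q.toLinearMap))).comap
      ((M.toScale t).prodMap (M.toScale r))
  have mem_V : ∀ {p q}, (p, q) ∈ V ↔
      ∃ z, M.coef (P z) = M.toScale t p ∧ M.coef (Q z) = M.toScale r q := fun {p q} => by
    simp [V, toScale_zero]
  have exists_mem_V : ∀ {p z}, M.toScale t p = M.coef (P z) →
      ∃ q, M.toScale r q = M.coef (Q z) ∧ (p, q) ∈ V := fun {p z} hp => by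
    obtain ⟨q, hq⟩ := M.memScale_iff_exists_toScale.1 (h.memScale (hp ▸ M.memScale_toScale t p))
    exact ⟨q, hq, mem_V.2 ⟨z, hp.symm, hq.symm⟩⟩
  have h_dense : Dense (Prod.fst '' (V : Set (X × X))) := fun x => by
    refine EMetric.mem_closure_iff.2 fun δ hδ => ?_
    obtain ⟨z, hz⟩ := h.1 _ (M.memScale_toScale t x) δ hδ
    obtain ⟨d, hd⟩ := M.memScale_iff_exists_toScale.1 (hz.trans_le le_top)
    obtain ⟨q, -, hq⟩ := exists_mem_V (p := x + d) (z := z) (by rw [map_add, hd]; abel)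
    refine ⟨x + d, mem_image_of_mem _ hq, ?_⟩
    rwa [edist_comm, edist_eq_enorm_sub, add_sub_cancel_left, ← M.scaleNorm_toScale t, hd]
  obtain ⟨L, hL⟩ := exists_clm_of_linearRelation V h_dense (C := c) fun ⟨p, q⟩ hpq => by
    obtain ⟨z, h_P, h_Q⟩ := mem_V.1 hpq
    refine norm_le_mul_norm_of_enorm_le ?_
    rw [← M.scaleNorm_toScale r, ← M.scaleNorm_toScale t, ← h_P, ← h_Q]
    exact h.2 z
  refine ⟨L, fun p z hp => ?_⟩
  obtain ⟨q, h_Q, hq⟩ := exists_mem_V hp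
  rw [hL _ hq, h_Q]

end Extension

namespace Assumptions

variable {s₀ β ℓ : ℝ} (hM : M.Assumptions s₀ β ℓ)
include hM

lemma Δ_pos : 0 < 2 * ℓ - β + 1 := by linarith [hM.s₀_nonneg, hM.illposed]

lemma exists_clm_eq_whitenedForward_sqrtC₀ :
    ∃ T : X →L[ℝ] X, ∀ x, T x = M.whitenedForward (M.sqrtC₀ x) := by
  obtain ⟨c, c', -, -, h⟩ := hM.forward
  have h_range : ∀ x, M.Ainv (M.sqrtC₀ x) ∈ range M.sqrtC₁ := fun x =>
    (h _ ((M.memScale_coef_sqrtC₀ x).mono (by linarith [hM.Δ_pos]))).1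
  obtain ⟨T, hT⟩ := exists_clm_comp_eq_of_range_subset M.sqrtC₁_injective
    (g := M.Ainv ∘L M.sqrtC₀) (range_subset_iff.2 h_range)
  exact ⟨T, fun x => M.sqrtC₁_injective ((hT x).trans (M.sqrtC₁_whitenedForward (h_range x)).symm)⟩

lemma exists_clm_isAinvC₁inv_iff :
    ∃ L : X →L[ℝ] X,
      (∀ p z, M.toScale (2 * β - 2 * ℓ - 1) p = M.coef (M.C₁ z) →
        M.toScale (-1) (L p) = M.coef (M.Ainv z)) ∧
      ∀ y r, M.IsAinvC₁inv β ℓ y r ↔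
        ∃ x, M.toScale (2 * β - 2 * ℓ - 1) x = y ∧ M.toScale (-1) (L x) = r := by
  obtain ⟨c₄, -, h⟩ := hM.data
  have h_ext := h 1 ⟨by linarith [hM.Δ_pos], le_rfl⟩
  obtain ⟨L, hL⟩ := h_ext.exists_clm
  -- approximations of the data in `X^{2β-2ℓ-1}` give approximations of its image under `L`
  have h_tendsto : ∀ {x : X} {z : ℕ → X},
      Tendsto (fun j => M.scaleNorm (2 * β - 2 * ℓ - 1)
        (M.coef (M.C₁ (z j)) - M.toScale (2 * β - 2 * ℓ - 1) x)) atTop (𝓝 0) →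
      Tendsto (fun j => M.scaleNorm (-1) (M.coef (M.Ainv (z j)) - M.toScale (-1) (L x)))
        atTop (𝓝 0) := fun hz => by
    obtain ⟨p, hp, hpz⟩ := M.exists_tendsto_of_tendsto_scaleNorm hz
    refine (M.tendsto_scaleNorm_sub_toScale_iff ?_).2 ((L.continuous.tendsto _).comp hp)
    filter_upwards [hpz] with j hj
    exact hL _ _ hj
  refine ⟨L, hL, fun y r => ⟨?_, ?_⟩⟩
  · rintro ⟨hy, hr, z, hz_y, hz_r⟩
    obtain ⟨x, rfl⟩ := M.memScale_iff_exists_toScale.1 hy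
    obtain ⟨g, rfl⟩ := M.memScale_iff_exists_toScale.1 hr
    obtain ⟨q, hq, hqz⟩ := M.exists_tendsto_of_tendsto_scaleNorm hz_r
    have hq' := (M.tendsto_scaleNorm_sub_toScale_iff hqz).1 (h_tendsto hz_y)
    exact ⟨x, rfl, congrArg _ (tendsto_nhds_unique hq' hq)⟩
  · rintro ⟨x, rfl, rfl⟩
    obtain ⟨z, hz⟩ := h_ext.exists_tendsto (M.memScale_toScale _ x)
    exact ⟨M.memScale_toScale _ _, M.memScale_toScale _ _, z, hz, h_tendsto hz⟩

lemma exists_clm_isPosteriorMean_iff {Λ : ℝ} (hΛ : 0 < Λ) :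
    ∃ S : X →L[ℝ] X, ∀ y w, M.IsPosteriorMean β ℓ Λ y w ↔
      ∃ x, M.toScale (2 * β - 2 * ℓ - 1) x = y ∧ w = S x := by
  obtain ⟨T, hT⟩ := hM.exists_clm_eq_whitenedForward_sqrtC₀
  obtain ⟨R, hR⟩ := exists_clm_isWeakSolution_iff hT hΛ
  obtain ⟨L, -, hL⟩ := hM.exists_clm_isAinvC₁inv_iff
  refine ⟨M.sqrtC₀ ∘L R ∘L L, fun y w => ⟨?_, ?_⟩⟩
  · rintro ⟨r, hr, hw⟩
    obtain ⟨x, hx, rfl⟩ := (hL y r).1 hr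
    exact ⟨x, hx, (hR _ _).1 hw⟩
  · rintro ⟨x, hx, rfl⟩
    exact ⟨_, (hL y _).2 ⟨x, hx, rfl⟩, (hR _ _).2 rfl⟩

lemma existsUnique_isPosteriorMean {Λ : ℝ} (hΛ : 0 < Λ) {y : ℕ → ℝ}
    (hy : M.MemScale (2 * β - 2 * ℓ - 1) y) : ∃! w, M.IsPosteriorMean β ℓ Λ y w := by
  obtain ⟨S, hS⟩ := hM.exists_clm_isPosteriorMean_iff hΛ
  obtain ⟨x, rfl⟩ := M.memScale_iff_exists_toScale.1 hy
  refine ⟨S x, (hS _ _).2 ⟨x, rfl, rfl⟩, fun w hw => ?_⟩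
  obtain ⟨x', hx', rfl⟩ := (hS _ _).1 hw
  rw [M.toScale_injective _ hx']

lemma isPosteriorMean_posteriorMean {Λ : ℝ} (hΛ : 0 < Λ) {y : ℕ → ℝ}
    (hy : M.MemScale (2 * β - 2 * ℓ - 1) y) :
    M.IsPosteriorMean β ℓ Λ y (M.posteriorMean β ℓ Λ y) :=
  Classical.epsilon_spec (hM.existsUnique_isPosteriorMean hΛ hy).exists

lemma aestronglyMeasurable_posteriorMean {Λ : ℝ} (hΛ : 0 < Λ) {Ω : Type*} [MeasurableSpace Ω]
    {P : Measure Ω} {y : Ω → ℕ → ℝ} (h_meas : ∀ k, AEMeasurable (fun ω => y ω k) P)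
    (hy : ∀ᵐ ω ∂P, M.MemScale (2 * β - 2 * ℓ - 1) (y ω)) :
    AEStronglyMeasurable (fun ω => M.posteriorMean β ℓ Λ (y ω)) P := by
  obtain ⟨S, hS⟩ := hM.exists_clm_isPosteriorMean_iff hΛ
  set t := 2 * β - 2 * ℓ - 1
  refine aestronglyMeasurable_of_tendsto_ae atTop (f := fun (N : ℕ) ω =>
    S (∑ k ∈ Finset.range N, (M.lam k ^ (-t) * y ω k) • M.φ k)) (fun N => ?_) ?_
  · exact S.continuous.comp_aestronglyMeasurable <| Finset.aestronglyMeasurable_fun_sum _ fun k _ =>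
      ((h_meas k).const_mul _).aestronglyMeasurable.smul_const _
  · filter_upwards [hy] with ω hω
    obtain ⟨x, hx, h_eq⟩ := (hS _ _).1 (hM.isPosteriorMean_posteriorMean hΛ hω)
    rw [h_eq]
    refine (S.continuous.tendsto x).comp ?_
    convert (M.φ.hasSum_repr x).tendsto_sum_nat using 5 with N k
    rw [HilbertBasis.repr_apply_apply, ← hx, toScale_apply, ← mul_assoc, lam_rpow_neg_mul, one_mul,
      coef]

lemma exists_enorm_inner_whitenedForward_le :
    ∃ C : ℝ≥0, ∀ s ∈ Ioc s₀ 1, ∀ h v : X, M.MemScale (s + β - 2 * ℓ) (M.coef v) →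
      ‖⟪h, M.whitenedForward v⟫_ℝ‖ₑ ≤
        C * M.scaleNorm (β - s) (M.coef (M.sqrtC₁ h)) * M.scaleNorm (s + β - 2 * ℓ) (M.coef v) := by
  obtain ⟨c₂, -, h_inv⟩ := hM.noise_inv
  obtain ⟨c₃, -, h_reg⟩ := hM.forward_reg
  refine ⟨c₂ * c₃, fun s hs h v hv => ?_⟩
  calc ‖⟪h, M.whitenedForward v⟫_ℝ‖ₑ
      ≤ M.scaleNorm (-s) (M.coef h) * M.scaleNorm s (M.coef (M.whitenedForward v)) := by
        rw [← (M.hasSum_coef_mul_coef h _).tsum_eq]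
        exact M.enorm_tsum_mul_le s _ _
    _ ≤ c₂ * M.scaleNorm (β - s) (M.coef (M.sqrtC₁ h)) *
          (c₃ * M.scaleNorm (s + β - 2 * ℓ) (M.coef v)) :=
        mul_le_mul' ((h_inv s hs).2 h) (h_reg s hs v hv).2
    _ = _ := by
        push_cast
        ring

lemma exists_tendsto_inner_Ainv {t : ℝ} (ht : t ∈ Icc (2 * β - 2 * ℓ - 1) β) {y r : ℕ → ℝ}
    (hy : M.MemScale t y) (hr : M.IsAinvC₁inv β ℓ y r) :
    ∃ z : ℕ → X, Tendsto (fun j => M.scaleNorm t (M.coef (M.C₁ (z j)) - y)) atTop (𝓝 0) ∧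
      ∀ v, M.MemScale 1 (M.coef v) →
        Tendsto (fun j => ⟪M.Ainv (z j), v⟫_ℝ) atTop (𝓝 (∑' k, r k * M.coef v k)) := by
  obtain ⟨c₄, -, h_data⟩ := hM.data
  have h_ext := h_data (2 * β - 2 * ℓ - t) ⟨by linarith [ht.2], by linarith [ht.1]⟩
  rw [sub_sub_cancel] at h_ext
  obtain ⟨z, hz⟩ := h_ext.exists_tendsto hy
  refine ⟨z, hz, fun v hv => ?_⟩
  obtain ⟨p, rfl⟩ := M.exists_sqrtC₀_eq hv
  obtain ⟨L, hL_z, hL⟩ := hM.exists_clm_isAinvC₁inv_iff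
  obtain ⟨x, rfl, rfl⟩ := (hL y r).1 hr
  obtain ⟨C, hC⟩ := M.exists_scaleNorm_le ht.1
  have hz' : Tendsto (fun j => M.scaleNorm (2 * β - 2 * ℓ - 1)
      (M.coef (M.C₁ (z j)) - M.toScale (2 * β - 2 * ℓ - 1) x)) atTop (𝓝 0) := by
    refine tendsto_of_tendsto_of_tendsto_of_le_of_le tendsto_const_nhds ?_
      (fun _ => zero_le) fun j => hC _
    simpa using ENNReal.Tendsto.const_mul hz (Or.inr ENNReal.coe_ne_top)
  obtain ⟨q, hq, hqz⟩ := M.exists_tendsto_of_tendsto_scaleNorm hz'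
  rw [coef_sqrtC₀, (M.hasSum_toScale_mul_toScale 1 (L x) p).tsum_eq]
  refine (((L.continuous.tendsto x).comp hq).inner tendsto_const_nhds).congr' ?_
  filter_upwards [hqz] with j hj
  rw [Function.comp_apply, ← (M.hasSum_toScale_mul_toScale 1 (L (q j)) p).tsum_eq, hL_z _ _ hj,
    ← coef_sqrtC₀, (M.hasSum_coef_mul_coef _ _).tsum_eq]

lemma exists_enorm_tsum_sub_inner_le :
    ∃ C : ℝ≥0, ∀ s ∈ Ioc s₀ 1, s ≤ 2 * ℓ - β + 1 → ∀ {y r : ℕ → ℝ}, M.MemScale (β - s) y →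
      M.IsAinvC₁inv β ℓ y r → ∀ h v : X, M.MemScale 1 (M.coef v) →
      ‖∑' k, r k * M.coef v k - ⟪h, M.whitenedForward v⟫_ℝ‖ₑ ≤
        C * M.scaleNorm (β - s) (y - M.coef (M.sqrtC₁ h)) *
          M.scaleNorm (s + β - 2 * ℓ) (M.coef v) := by
  obtain ⟨_, _, -, -, h_forward⟩ := hM.forward
  obtain ⟨C, hC⟩ := hM.exists_enorm_inner_whitenedForward_le
  refine ⟨C, fun s hs hsΔ y r hy hr h v hv => ?_⟩
  have hv_κ := hv.mono (show β - 2 * ℓ ≤ 1 by linarith [hM.Δ_pos])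
  have hv_s := hv.mono (show s + β - 2 * ℓ ≤ 1 by linarith)
  obtain ⟨z, hz, h_tendsto⟩ := hM.exists_tendsto_inner_Ainv
    ⟨by linarith, by linarith [hs.1, hM.s₀_nonneg]⟩ hy hr
  have h_approx : ∀ j, ‖⟪M.Ainv (z j), v⟫_ℝ - ⟪h, M.whitenedForward v⟫_ℝ‖ₑ ≤
      C * (M.scaleNorm (β - s) (M.coef (M.C₁ (z j)) - y) +
        M.scaleNorm (β - s) (y - M.coef (M.sqrtC₁ h))) *
        M.scaleNorm (s + β - 2 * ℓ) (M.coef v) := fun j => by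
    rw [inner_Ainv_left, ← M.sqrtC₁_whitenedForward (h_forward v hv_κ).1, ← inner_sqrtC₁_left,
      ← inner_sub_left]
    refine (hC s hs _ v hv_s).trans ?_
    rw [map_sub, sqrtC₁_sqrtC₁, coef_sub]
    gcongr
    exact M.scaleNorm_sub_le _ _ _ _
  refine le_of_tendsto_of_tendsto' ((h_tendsto v hv).sub tendsto_const_nhds).enorm ?_ h_approx
  have h_lim := ENNReal.Tendsto.mul_const (b := M.scaleNorm (s + β - 2 * ℓ) (M.coef v))
    (ENNReal.Tendsto.const_mul (a := C)
      (hz.add_const (M.scaleNorm (β - s) (y - M.coef (M.sqrtC₁ h))))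
      (Or.inr ENNReal.coe_ne_top)) (Or.inr hv_s.ne)
  rwa [zero_add] at h_lim

end Assumptions

/-! ### The error equation -/

variable (M)

lemma enorm_tsum_weight_mul_le (γ : ℝ) (a b : ℕ → ℝ) :
    ‖∑' k, M.lam k ^ (-2 : ℝ) * (a k * b k)‖ₑ ≤ M.scaleNorm γ a * M.scaleNorm (2 - γ) b := by
  have h_shift : M.scaleNorm (-(2 - γ)) (fun k => M.lam k ^ (-2 : ℝ) * a k) = M.scaleNorm γ a := by
    simp only [scaleNorm_eq_eLpNorm]
    congr 1 with k
    rw [← mul_assoc, ← Real.rpow_add (M.lam_pos k)]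
    congr 2
    ring
  simpa only [h_shift, mul_assoc] using
    M.enorm_tsum_mul_le (2 - γ) (fun k => M.lam k ^ (-2 : ℝ) * a k) b

lemma form_self_sqrtC₀ (Λ : ℝ) (x : X) : M.form Λ (M.sqrtC₀ x) (M.sqrtC₀ x)
    = ‖M.whitenedForward (M.sqrtC₀ x)‖ ^ 2 + Λ * ‖x‖ ^ 2 := by
  rw [form_sqrtC₀, real_inner_self_eq_norm_sq, real_inner_self_eq_norm_sq]

/-- The energy norm of the variational problem `form Λ w v = ⟨r, v⟩` for `v ∈ X^1`. -/
noncomputable def energyNorm (Λ : ℝ) (v : X) : ℝ := √(M.form Λ v v)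

variable {M}

lemma energyNorm_sq {Λ : ℝ} (hΛ : 0 < Λ) {v : X} (hv : M.MemScale 1 (M.coef v)) :
    M.energyNorm Λ v ^ 2 = M.form Λ v v := by
  obtain ⟨x, rfl⟩ := M.exists_sqrtC₀_eq hv
  refine Real.sq_sqrt ?_
  rw [form_self_sqrtC₀]
  positivity

lemma norm_whitenedForward_le_energyNorm {Λ : ℝ} (hΛ : 0 < Λ) {v : X}
    (hv : M.MemScale 1 (M.coef v)) : ‖M.whitenedForward v‖ ≤ M.energyNorm Λ v := by
  obtain ⟨x, rfl⟩ := M.exists_sqrtC₀_eq hv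
  refine Real.le_sqrt_of_sq_le ?_
  rw [form_self_sqrtC₀]
  exact le_add_of_nonneg_right (by positivity)

lemma scaleNorm_one_le_energyNorm {Λ : ℝ} (hΛ : 0 < Λ) {v : X} (hv : M.MemScale 1 (M.coef v)) :
    M.scaleNorm 1 (M.coef v) ≤ ENNReal.ofReal (Λ ^ (-(1 / 2) : ℝ) * M.energyNorm Λ v) := by
  obtain ⟨x, rfl⟩ := M.exists_sqrtC₀_eq hv
  rw [coef_sqrtC₀, scaleNorm_toScale, ← ofReal_norm, Real.rpow_neg hΛ.le, ← Real.sqrt_eq_rpow]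
  refine ENNReal.ofReal_le_ofReal ((le_inv_mul_iff₀ (Real.sqrt_pos.2 hΛ)).2 ?_)
  refine Real.le_sqrt_of_sq_le ?_
  rw [form_self_sqrtC₀, mul_pow, Real.sq_sqrt hΛ.le]
  exact le_add_of_nonneg_left (sq_nonneg _)

namespace Assumptions

variable {s₀ β ℓ : ℝ} (hM : M.Assumptions s₀ β ℓ)
include hM

lemma exists_scaleNorm_le_energyNorm :
    ∃ K : ℝ≥0, ∀ {Λ : ℝ}, 0 < Λ → ∀ {a : ℝ}, a ∈ Icc 0 1 → ∀ {v : X}, M.MemScale 1 (M.coef v) →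
      M.scaleNorm (β - 2 * ℓ + a * (2 * ℓ - β + 1)) (M.coef v) ≤
        K * ENNReal.ofReal (Λ ^ (-(a / 2))) * ENNReal.ofReal (M.energyNorm Λ v) := by
  obtain ⟨c, _, hc, -, h_forward⟩ := hM.forward
  refine ⟨max c⁻¹ 1, fun {Λ} hΛ {a} ha {v} hv => ?_⟩
  set N := ENNReal.ofReal (M.energyNorm Λ v)
  have h_κ : M.scaleNorm (β - 2 * ℓ) (M.coef v) ≤ (c⁻¹ : ℝ≥0) * N := by
    have h_lower := (h_forward v (hv.mono (by linarith [hM.Δ_pos]))).2.1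
    rw [ENNReal.coe_inv hc.ne', ← ENNReal.mul_le_iff_le_inv (by simpa using hc.ne')
      ENNReal.coe_ne_top]
    refine h_lower.trans ?_
    rw [← ofReal_norm]
    exact ENNReal.ofReal_le_ofReal (norm_whitenedForward_le_energyNorm hΛ hv)
  have h_one : M.scaleNorm 1 (M.coef v) ≤ ENNReal.ofReal (Λ ^ (-(1 / 2) : ℝ)) * N := by
    rw [← ENNReal.ofReal_mul (by positivity)]
    exact scaleNorm_one_le_energyNorm hΛ hv
  have h_const : ((c⁻¹ : ℝ≥0) : ℝ≥0∞) ^ (1 - a) ≤ (max c⁻¹ 1 : ℝ≥0) := by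
    refine (ENNReal.rpow_le_rpow (ENNReal.coe_le_coe.2 (le_max_left _ 1))
      (sub_nonneg.2 ha.2)).trans ?_
    refine (ENNReal.rpow_le_rpow_of_exponent_le ?_ (sub_le_self 1 ha.1)).trans_eq
      (ENNReal.rpow_one _)
    exact ENNReal.coe_le_coe.2 (le_max_right _ _)
  have h_index : β - 2 * ℓ + a * (2 * ℓ - β + 1) = (1 - a) * (β - 2 * ℓ) + a * 1 := by ring
  calc M.scaleNorm (β - 2 * ℓ + a * (2 * ℓ - β + 1)) (M.coef v)
      ≤ M.scaleNorm (β - 2 * ℓ) (M.coef v) ^ (1 - a) * M.scaleNorm 1 (M.coef v) ^ a :=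
        h_index ▸ M.scaleNorm_interpolation _ _ ha _
    _ ≤ ((c⁻¹ : ℝ≥0) * N) ^ (1 - a) * (ENNReal.ofReal (Λ ^ (-(1 / 2) : ℝ)) * N) ^ a :=
        mul_le_mul' (ENNReal.rpow_le_rpow h_κ (sub_nonneg.2 ha.2)) (ENNReal.rpow_le_rpow h_one ha.1)
    _ = ((c⁻¹ : ℝ≥0) : ℝ≥0∞) ^ (1 - a) * ENNReal.ofReal (Λ ^ (-(a / 2))) * N := by
        rw [ENNReal.mul_rpow_of_nonneg _ _ (sub_nonneg.2 ha.2), ENNReal.mul_rpow_of_nonneg _ _ ha.1,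
          mul_mul_mul_comm, ← ENNReal.rpow_add_of_nonneg _ _ (sub_nonneg.2 ha.2) ha.1,
          sub_add_cancel, ENNReal.rpow_one, ENNReal.ofReal_rpow_of_nonneg (by positivity) ha.1,
          ← Real.rpow_mul hΛ.le]
        congr 4
        ring
    _ ≤ (max c⁻¹ 1 : ℝ≥0) * ENNReal.ofReal (Λ ^ (-(a / 2))) * N := by gcongr

lemma form_sub_left (Λ : ℝ) {w u v : X} (hw : M.MemScale 1 (M.coef w))
    (hu : M.MemScale 1 (M.coef u)) (hv : M.MemScale 1 (M.coef v)) :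
    M.form Λ (w - u) v = M.form Λ w v - M.form Λ u v := by
  obtain ⟨T, hT⟩ := hM.exists_clm_eq_whitenedForward_sqrtC₀
  obtain ⟨x, rfl⟩ := M.exists_sqrtC₀_eq hw
  obtain ⟨b, rfl⟩ := M.exists_sqrtC₀_eq hu
  obtain ⟨p, rfl⟩ := M.exists_sqrtC₀_eq hv
  rw [← map_sub, form_sqrtC₀, form_sqrtC₀, form_sqrtC₀, ← hT, ← hT, ← hT, ← hT, map_sub,
    inner_sub_left, inner_sub_left]
  ring

lemma form_sub_of_isWeakSolution {Λ : ℝ} {r : ℕ → ℝ} {w u v : X} (h : M.IsWeakSolution Λ r w)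
    (hu : M.MemScale 1 (M.coef u)) (hv : M.MemScale 1 (M.coef v)) :
    M.form Λ (w - u) v =
      (∑' k, r k * M.coef v k - ⟪M.whitenedForward u, M.whitenedForward v⟫_ℝ)
        - Λ * ∑' k, M.lam k ^ (-2 : ℝ) * (M.coef u k * M.coef v k) := by
  rw [hM.form_sub_left Λ h.2.1 hu hv, h.2.2 v hv, form, whitenedForward, whitenedForward]
  ring

lemma exists_noise_le_energyNorm {s : ℝ} (hs : s ∈ Ioc s₀ 1) (hsΔ : s ≤ 2 * ℓ - β + 1) :
    ∃ C : ℝ≥0, ∀ {Λ : ℝ}, 0 < Λ → ∀ {y r : ℕ → ℝ}, M.MemScale (β - s) y →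
      M.IsAinvC₁inv β ℓ y r → ∀ {u v : X}, M.MemScale 1 (M.coef u) → M.MemScale 1 (M.coef v) →
      ‖∑' k, r k * M.coef v k - ⟪M.whitenedForward u, M.whitenedForward v⟫_ℝ‖ₑ ≤
        C * ENNReal.ofReal (Λ ^ (-(s / (2 * ℓ - β + 1) / 2))) *
          M.scaleNorm (β - s) (y - M.coef (M.Ainv u)) * ENNReal.ofReal (M.energyNorm Λ v) := by
  obtain ⟨_, _, -, -, h_forward⟩ := hM.forward
  obtain ⟨C, hC⟩ := hM.exists_enorm_tsum_sub_inner_le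
  obtain ⟨K, hK⟩ := hM.exists_scaleNorm_le_energyNorm
  refine ⟨C * K, fun {Λ} hΛ {y r} hy hr {u v} hu hv => ?_⟩
  have h_range := (h_forward u (hu.mono (by linarith [hM.Δ_pos]))).1
  have h_index : s + β - 2 * ℓ = β - 2 * ℓ + s / (2 * ℓ - β + 1) * (2 * ℓ - β + 1) := by
    rw [div_mul_cancel₀ _ hM.Δ_pos.ne']
    ring
  have h_mem : s / (2 * ℓ - β + 1) ∈ Icc 0 1 :=
    ⟨div_nonneg (hM.s₀_nonneg.trans hs.1.le) hM.Δ_pos.le, (div_le_one hM.Δ_pos).2 hsΔ⟩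
  have h_residual := hC s hs hsΔ hy hr (M.whitenedForward u) v hv
  rw [M.sqrtC₁_whitenedForward h_range, h_index] at h_residual
  refine h_residual.trans ((mul_le_mul_right (hK hΛ h_mem hv) _).trans_eq ?_)
  push_cast
  ring

lemma exists_bias_le_energyNorm {γ : ℝ} (hγ : γ ∈ Icc 1 (2 * ℓ - β + 1 + 1)) :
    ∃ C : ℝ≥0, ∀ {Λ : ℝ}, 0 < Λ → ∀ (u : X) {v : X}, M.MemScale 1 (M.coef v) →
      ‖Λ * ∑' k, M.lam k ^ (-2 : ℝ) * (M.coef u k * M.coef v k)‖ₑ ≤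
        C * ENNReal.ofReal (Λ ^ ((1 + (γ - 1) / (2 * ℓ - β + 1)) / 2)) *
          M.scaleNorm γ (M.coef u) * ENNReal.ofReal (M.energyNorm Λ v) := by
  obtain ⟨K, hK⟩ := hM.exists_scaleNorm_le_energyNorm
  refine ⟨K, fun {Λ} hΛ u {v} hv => ?_⟩
  set a := 1 - (γ - 1) / (2 * ℓ - β + 1) with ha
  have h_index : 2 - γ = β - 2 * ℓ + a * (2 * ℓ - β + 1) := by
    rw [ha, sub_mul, div_mul_cancel₀ _ hM.Δ_pos.ne']
    ring
  have h_mem : a ∈ Icc 0 1 := by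
    refine ⟨sub_nonneg.2 ((div_le_one hM.Δ_pos).2 (by linarith [hγ.2])), sub_le_self 1 ?_⟩
    exact div_nonneg (sub_nonneg.2 hγ.1) hM.Δ_pos.le
  have h_power : ENNReal.ofReal Λ * ENNReal.ofReal (Λ ^ (-(a / 2))) =
      ENNReal.ofReal (Λ ^ ((1 + (γ - 1) / (2 * ℓ - β + 1)) / 2)) := by
    rw [← ENNReal.ofReal_mul hΛ.le, ← Real.rpow_one_add' hΛ.le (by linarith [h_mem.2])]
    congr 2
    ring
  calc ‖Λ * ∑' k, M.lam k ^ (-2 : ℝ) * (M.coef u k * M.coef v k)‖ₑ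
      ≤ ENNReal.ofReal Λ * (M.scaleNorm γ (M.coef u) * M.scaleNorm (2 - γ) (M.coef v)) := by
        rw [enorm_mul, Real.enorm_of_nonneg hΛ.le]
        gcongr
        exact M.enorm_tsum_weight_mul_le γ _ _
    _ ≤ ENNReal.ofReal Λ * (M.scaleNorm γ (M.coef u) *
          (K * ENNReal.ofReal (Λ ^ (-(a / 2))) * ENNReal.ofReal (M.energyNorm Λ v))) := by
        rw [h_index]
        gcongr
        exact hK hΛ h_mem hv
    _ = _ := by
        rw [← h_power]
        ring

lemma exists_energyNorm_sub_le {s γ : ℝ} (hs : s ∈ Ioc s₀ 1) (hsΔ : s ≤ 2 * ℓ - β + 1)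
    (hγ : γ ∈ Icc 1 (2 * ℓ - β + 1 + 1)) {u : X} (hu : M.MemScale γ (M.coef u)) :
    ∃ C : ℝ≥0, ∀ {Λ : ℝ}, 0 < Λ → ∀ {y : ℕ → ℝ} {w : X}, M.MemScale (β - s) y →
      M.IsPosteriorMean β ℓ Λ y w →
      ENNReal.ofReal (M.energyNorm Λ (w - u)) ≤
        C * (ENNReal.ofReal (Λ ^ (-(s / (2 * ℓ - β + 1) / 2))) *
            M.scaleNorm (β - s) (y - M.coef (M.Ainv u))
          + ENNReal.ofReal (Λ ^ ((1 + (γ - 1) / (2 * ℓ - β + 1)) / 2))) := by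
  obtain ⟨C₁, h_noise⟩ := hM.exists_noise_le_energyNorm hs hsΔ
  obtain ⟨C₂, h_bias⟩ := hM.exists_bias_le_energyNorm hγ
  obtain ⟨U, hU⟩ : ∃ U : ℝ≥0, M.scaleNorm γ (M.coef u) = U := ⟨_, (ENNReal.coe_toNNReal hu.ne).symm⟩
  refine ⟨max C₁ (C₂ * U), fun {Λ} hΛ {y w} hy ⟨r, hr, hw⟩ => ?_⟩
  set a := ENNReal.ofReal (Λ ^ (-(s / (2 * ℓ - β + 1) / 2)))
  set b := ENNReal.ofReal (Λ ^ ((1 + (γ - 1) / (2 * ℓ - β + 1)) / 2))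
  set Z := M.scaleNorm (β - s) (y - M.coef (M.Ainv u))
  set N := ENNReal.ofReal (M.energyNorm Λ (w - u))
  have he : M.MemScale 1 (M.coef (w - u)) := by
    rw [coef_sub]
    exact hw.2.1.sub (hu.mono hγ.1)
  -- the weak formulation of the equation, tested with the error `w - u`
  have h_sq : N * N ≤ N * (C₁ * a * Z + C₂ * b * U) := by
    calc N * N = ENNReal.ofReal (M.form Λ (w - u) (w - u)) := by
          rw [← energyNorm_sq hΛ he, sq,
            ENNReal.ofReal_mul (p := M.energyNorm Λ _) (Real.sqrt_nonneg _)]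
      _ ≤ ‖M.form Λ (w - u) (w - u)‖ₑ := Real.ofReal_le_enorm _
      _ ≤ C₁ * a * Z * N + C₂ * b * U * N := by
          rw [hM.form_sub_of_isWeakSolution hw (hu.mono hγ.1) he]
          exact enorm_sub_le.trans
            (add_le_add (h_noise hΛ hy hr (hu.mono hγ.1) he) (hU ▸ h_bias hΛ u he))
      _ = N * (C₁ * a * Z + C₂ * b * U) := by ring
  have h_div : N ≤ C₁ * a * Z + C₂ * b * U := by
    rcases eq_or_ne N 0 with h | h
    · exact h ▸ zero_le
    · exact (ENNReal.mul_le_mul_iff_right h ENNReal.ofReal_ne_top).1 h_sq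
  refine h_div.trans ?_
  rw [mul_add, mul_assoc, mul_right_comm]
  gcongr
  · exact le_max_left _ _
  · exact_mod_cast le_max_right C₁ (C₂ * U)

end Assumptions

/-! ### Second moments of the noise -/

variable (M)

lemma scaleNorm_coef_basis (t : ℝ) (j : ℕ) :
    M.scaleNorm t (M.coef (M.φ j)) = ENNReal.ofReal (M.lam j ^ (-t)) := by
  have h_coef : M.coef (M.φ j) = M.toScale t (M.lam j ^ (-t) • M.φ j) := by
    ext k
    simp only [toScale_apply, coef, inner_smul_right, orthonormal_iff_ite.1 M.φ.orthonormal]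
    split_ifs with h
    · subst h
      linear_combination -M.lam_rpow_neg_mul k t
    · simp
  rw [h_coef, scaleNorm_toScale, ← ofReal_norm, norm_smul, M.φ.orthonormal.1 j, mul_one,
    Real.norm_of_nonneg (M.lam_rpow_pos j _).le]

variable {M}

section Noise

variable {Ω : Type*} [MeasurableSpace Ω] {P : Measure Ω} {ξ : Ω → ℕ → ℝ} (hξ : M.IsNoise P ξ)
include hξ

lemma IsNoise.hasLaw (k : ℕ) :
    HasLaw (fun ω => ξ ω k) (gaussianReal 0 (‖M.sqrtC₁ (M.φ k)‖ ^ 2).toNNReal) P := by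
  simpa [inner_C₁_self] using hξ (Finsupp.single k 1)

lemma IsNoise.lintegral_sq (k : ℕ) :
    ∫⁻ ω, ENNReal.ofReal (ξ ω k ^ 2) ∂P = ENNReal.ofReal (‖M.sqrtC₁ (M.φ k)‖ ^ 2) := by
  rw [(hξ.hasLaw k).lintegral_comp (f := fun x => ENNReal.ofReal (x ^ 2)) (by fun_prop)]
  set v := (‖M.sqrtC₁ (M.φ k)‖ ^ 2).toNNReal
  have h_memLp : MemLp id 2 (gaussianReal 0 v) := memLp_id_gaussianReal 2
  have h_var : ∫ x, x ^ 2 ∂gaussianReal 0 v = v := by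
    rw [← variance_id_gaussianReal (μ := 0) (v := v), variance_eq_sub h_memLp]
    simp
  refine (ofReal_integral_eq_lintegral_ofReal h_memLp.integrable_sq
    (ae_of_all _ fun x => sq_nonneg x)).symm.trans ?_
  exact (congrArg ENNReal.ofReal h_var).trans ENNReal.ofReal_coe_nnreal

lemma IsNoise.aemeasurable_weight_mul_sq (t : ℝ) (k : ℕ) :
    AEMeasurable (fun ω => ENNReal.ofReal (M.lam k ^ (-2 * t) * ξ ω k ^ 2)) P :=
  (((hξ.hasLaw k).aemeasurable.pow_const 2).const_mul _).ennreal_ofReal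

lemma IsNoise.aemeasurable_scaleNorm_sq (t : ℝ) :
    AEMeasurable (fun ω => M.scaleNorm t (ξ ω) ^ 2) P := by
  simp only [scaleNorm_sq]
  exact .tsum fun k => hξ.aemeasurable_weight_mul_sq t k

lemma IsNoise.lintegral_scaleNorm_sq (t : ℝ) :
    ∫⁻ ω, M.scaleNorm t (ξ ω) ^ 2 ∂P = ∑' j, M.scaleNorm t (M.coef (M.sqrtC₁ (M.φ j))) ^ 2 := by
  have h_parseval : ∀ k, ENNReal.ofReal (‖M.sqrtC₁ (M.φ k)‖ ^ 2) =
      ∑' j, ENNReal.ofReal (M.coef (M.sqrtC₁ (M.φ j)) k ^ 2) := fun k => by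
    have h_sum := M.hasSum_coef_mul_coef (M.sqrtC₁ (M.φ k)) (M.sqrtC₁ (M.φ k))
    rw [← real_inner_self_eq_norm_sq, ← h_sum.tsum_eq,
      ENNReal.ofReal_tsum_of_nonneg (fun j => mul_self_nonneg _) h_sum.summable]
    simp only [coef, ← inner_sqrtC₁_left, ← sq, real_inner_comm (M.φ k)]
  calc ∫⁻ ω, M.scaleNorm t (ξ ω) ^ 2 ∂P
      = ∑' k, ENNReal.ofReal (M.lam k ^ (-2 * t)) * ENNReal.ofReal (‖M.sqrtC₁ (M.φ k)‖ ^ 2) := by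
        simp only [scaleNorm_sq]
        rw [lintegral_tsum fun k => hξ.aemeasurable_weight_mul_sq t k]
        refine tsum_congr fun k => ?_
        simp only [ENNReal.ofReal_mul (M.lam_rpow_pos k _).le]
        rw [lintegral_const_mul' _ _ ENNReal.ofReal_ne_top, hξ.lintegral_sq]
    _ = ∑' k, ∑' j, ENNReal.ofReal (M.lam k ^ (-2 * t) * M.coef (M.sqrtC₁ (M.φ j)) k ^ 2) := by
        simp only [h_parseval, ← ENNReal.tsum_mul_left, ENNReal.ofReal_mul (M.lam_rpow_pos _ _).le]
    _ = ∑' j, M.scaleNorm t (M.coef (M.sqrtC₁ (M.φ j))) ^ 2 := by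
        simp only [scaleNorm_sq]
        exact ENNReal.tsum_comm

end Noise

namespace Assumptions

variable {s₀ β ℓ : ℝ} (hM : M.Assumptions s₀ β ℓ)
include hM

lemma lintegral_scaleNorm_noise_sq_lt_top {Ω : Type*} [MeasurableSpace Ω] {P : Measure Ω}
    {ξ : Ω → ℕ → ℝ} (hξ : M.IsNoise P ξ) {s : ℝ} (hs : s₀ < s)
    (hs' : (⌈β - s₀ - 1⌉ : ℝ) ≤ β - s) : ∫⁻ ω, M.scaleNorm (β - s) (ξ ω) ^ 2 ∂P < ∞ := by
  obtain ⟨c, -, h_noise⟩ := hM.noise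
  have h_ext := h_noise (β - s) ⟨hs', by linarith⟩
  rw [sub_sub_cancel_left] at h_ext
  calc ∫⁻ ω, M.scaleNorm (β - s) (ξ ω) ^ 2 ∂P
      = ∑' j, M.scaleNorm (β - s) (M.coef (M.sqrtC₁ (M.φ j))) ^ 2 := hξ.lintegral_scaleNorm_sq _
    _ ≤ ∑' j, (c : ℝ≥0∞) ^ 2 * ENNReal.ofReal (M.lam j ^ (2 * s)) := by
        refine ENNReal.tsum_le_tsum fun j => (pow_le_pow_left' (h_ext.2 (M.φ j)) 2).trans_eq ?_
        rw [mul_pow, ContinuousLinearMap.id_apply, scaleNorm_coef_basis, neg_neg,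
          ← ENNReal.ofReal_pow (M.lam_rpow_pos j _).le, ← Real.rpow_mul_natCast (M.lam_pos j).le,
          mul_comm s]
        norm_cast
    _ < ∞ := by
        rw [ENNReal.tsum_mul_left]
        exact ENNReal.mul_lt_top (by finiteness) (hM.trace s hs).tsum_ofReal_lt_top

lemma memScale_Ainv {t : ℝ} (ht : t ∈ Ico (⌈β - s₀ - 1⌉ : ℝ) (β - s₀)) {u : X}
    (hu : M.MemScale 1 (M.coef u)) : M.MemScale t (M.coef (M.Ainv u)) := by
  obtain ⟨_, _, -, -, h_forward⟩ := hM.forward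
  obtain ⟨c, -, h_noise⟩ := hM.noise
  rw [← M.sqrtC₁_whitenedForward (h_forward u (hu.mono (by linarith [hM.Δ_pos]))).1]
  have h_mem : M.MemScale 0 (M.coef (M.whitenedForward u)) := by
    rw [← toScale_zero]
    exact M.memScale_toScale 0 _
  exact (h_noise t ht).memScale (h_mem.mono (by linarith [ht.2, hM.s₀_nonneg]))

end Assumptions

/-! ### Convergence rates -/

lemma regularization_rpow_eq {n b G : ℝ} (hn : 0 < n) (hG : G ≠ 0) :
    1 / (n * (n ^ (-(b / (2 * G)))) ^ 2) = n ^ (-((G - b) / G)) := by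
  rw [← Real.rpow_mul_natCast hn.le, one_div]
  nth_rewrite 1 [← Real.rpow_one n]
  rw [← Real.rpow_add hn, ← Real.rpow_neg hn.le]
  congr 1
  push_cast
  field_simp
  ring

lemma variance_rpow_le {n Δ G ρ s θ : ℝ} (hn : 1 ≤ n) (hΔ : Δ ≠ 0) (hG : 0 < G) (hs : s ≤ G - ρ) :
    (n ^ (-(Δ / G))) ^ (-(θ + s / Δ)) / n ≤ n ^ (-((ρ - θ * Δ) / G)) := by
  have hn0 : 0 < n := zero_lt_one.trans_le hn
  have h_exponent : -(Δ / G) * -(θ + s / Δ) - 1 = (θ * Δ + s - G) / G := by field_simp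
  rw [← Real.rpow_mul hn0.le, ← Real.rpow_sub_one hn0.ne', h_exponent, ← neg_div]
  gcongr
  linarith

lemma bias_rpow_eq {n Δ G γ θ : ℝ} (hn : 0 ≤ n) (hΔ : Δ ≠ 0) :
    (n ^ (-(Δ / G))) ^ (1 - θ + (γ - 1) / Δ) = n ^ (-((Δ + γ - 1 - θ * Δ) / G)) := by
  rw [← Real.rpow_mul hn]
  congr 1
  field_simp
  ring

lemma ofReal_rpow_mul_ofReal_rpow_sq {x : ℝ} (hx : 0 < x) (a b : ℝ) :
    (ENNReal.ofReal (x ^ a) * ENNReal.ofReal (x ^ b)) ^ 2 = ENNReal.ofReal (x ^ (2 * (a + b))) := by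
  rw [← ENNReal.ofReal_mul (by positivity), ← Real.rpow_add hx,
    ← ENNReal.ofReal_pow (by positivity), ← Real.rpow_mul_natCast hx.le, Nat.cast_two, mul_comm]

lemma data_sub_coef (u : X) (n : ℝ) (ξ : ℕ → ℝ) :
    M.data u n ξ - M.coef (M.Ainv u) = (√n)⁻¹ • ξ :=
  add_sub_cancel_left _ ((√n)⁻¹ • ξ)

namespace Assumptions

variable {s₀ β ℓ : ℝ} (hM : M.Assumptions s₀ β ℓ)
include hM

lemma exists_scaleNorm_sub_sq_le {s γ θ : ℝ} (hs : s ∈ Ioc s₀ 1) (hsΔ : s ≤ 2 * ℓ - β + 1)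
    (hγ : γ ∈ Icc 1 (2 * ℓ - β + 1 + 1)) (hθ : θ ∈ Icc 0 1) {u : X}
    (hu : M.MemScale γ (M.coef u)) :
    ∃ C : ℝ≥0, ∀ {Λ : ℝ}, 0 < Λ → ∀ {y : ℕ → ℝ} {w : X}, M.MemScale (β - s) y →
      M.IsPosteriorMean β ℓ Λ y w →
      M.scaleNorm ((1 - θ) * (β - 2 * ℓ) + θ) (M.coef (w - u)) ^ 2 ≤
        C * (ENNReal.ofReal (Λ ^ (-(θ + s / (2 * ℓ - β + 1)))) *
            M.scaleNorm (β - s) (y - M.coef (M.Ainv u)) ^ 2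
          + ENNReal.ofReal (Λ ^ (1 - θ + (γ - 1) / (2 * ℓ - β + 1)))) := by
  obtain ⟨K, hK⟩ := hM.exists_scaleNorm_le_energyNorm
  obtain ⟨C, hC⟩ := hM.exists_energyNorm_sub_le hs hsΔ hγ hu
  refine ⟨2 * (K * C) ^ 2, fun {Λ} hΛ {y w} hy hw => ?_⟩
  have h_index : (1 - θ) * (β - 2 * ℓ) + θ = β - 2 * ℓ + θ * (2 * ℓ - β + 1) := by ring
  have h_mem : M.MemScale 1 (M.coef (w - u)) := by
    obtain ⟨r, -, h_weak⟩ := hw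
    rw [coef_sub]
    exact h_weak.2.1.sub (hu.mono hγ.1)
  set Δ := 2 * ℓ - β + 1
  set Z := M.scaleNorm (β - s) (y - M.coef (M.Ainv u))
  set p := ENNReal.ofReal (Λ ^ (-(θ / 2)))
  set q := ENNReal.ofReal (Λ ^ (-(s / Δ / 2)))
  set b := ENNReal.ofReal (Λ ^ ((1 + (γ - 1) / Δ) / 2))
  have h_variance : ENNReal.ofReal (Λ ^ (-(θ + s / Δ))) = (p * q) ^ 2 := by
    rw [ofReal_rpow_mul_ofReal_rpow_sq hΛ]
    ring_nf
  have h_bias : ENNReal.ofReal (Λ ^ (1 - θ + (γ - 1) / Δ)) = (p * b) ^ 2 := by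
    rw [ofReal_rpow_mul_ofReal_rpow_sq hΛ]
    ring_nf
  calc M.scaleNorm ((1 - θ) * (β - 2 * ℓ) + θ) (M.coef (w - u)) ^ 2
      ≤ (K * p * (C * (q * Z + b))) ^ 2 := by
        rw [h_index]
        gcongr
        exact (hK hΛ hθ h_mem).trans (by gcongr; exact hC hΛ hy hw)
    _ = (K * C) ^ 2 * (p * q * Z + p * b) ^ 2 := by ring
    _ ≤ (K * C) ^ 2 * (2 * ((p * q * Z) ^ 2 + (p * b) ^ 2)) := by
        gcongr
        simpa [one_add_one_eq_two, show (2 : ℝ) - 1 = 1 by norm_num] using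
          ENNReal.rpow_add_le_mul_rpow_add_rpow (p * q * Z) (p * b) one_le_two
    _ = _ := by
        rw [h_variance, h_bias]
        push_cast
        ring

lemma exists_noise_index {ε : ℝ} (hε : 0 < ε) :
    ∃ s ∈ Ioc s₀ 1, s ≤ 2 * ℓ - β + 1 ∧ (⌈β - s₀ - 1⌉ : ℝ) ≤ β - s ∧ s ≤ s₀ + ε := by
  refine ⟨min (min (s₀ + ε) (2 * ℓ - β + 1)) (min (β - ⌈β - s₀ - 1⌉) 1), ⟨?_, by simp⟩, by simp,
    le_sub_comm.1 (by simp), by simp⟩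
  have h_ceil := Int.ceil_lt_add_one (β - s₀ - 1)
  refine lt_min (lt_min (by linarith) ?_) (lt_min (by linarith) hM.s₀_lt_one)
  linarith [hM.illposed, hM.s₀_nonneg]

section Data

variable {Ω : Type*} [MeasurableSpace Ω] {P : Measure Ω} {ξ : Ω → ℕ → ℝ} (hξ : M.IsNoise P ξ)
  {s : ℝ} (hs : s₀ < s) (hs' : (⌈β - s₀ - 1⌉ : ℝ) ≤ β - s) {u : X}
include hξ hs hs'

lemma ae_memScale_data (hu : M.MemScale 1 (M.coef u)) (n : ℝ) :
    ∀ᵐ ω ∂P, M.MemScale (β - s) (M.data u n (ξ ω)) := by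
  have h_signal : M.MemScale (β - s) (M.coef (M.Ainv u)) := hM.memScale_Ainv ⟨hs', by linarith⟩ hu
  filter_upwards [ae_lt_top' (hξ.aemeasurable_scaleNorm_sq (β - s))
    (hM.lintegral_scaleNorm_noise_sq_lt_top hξ hs hs').ne] with ω hω
  have h_noise : M.MemScale (β - s) (ξ ω) := (ENNReal.pow_lt_top_iff.1 hω).resolve_right two_ne_zero
  exact h_signal.add (h_noise.smul _)

lemma exists_lintegral_scaleNorm_sub_sq_le [IsProbabilityMeasure P] (hs1 : s ≤ 1)
    (hsΔ : s ≤ 2 * ℓ - β + 1) {γ θ : ℝ} (hγ : γ ∈ Icc 1 (2 * ℓ - β + 1 + 1)) (hθ : θ ∈ Icc 0 1)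
    (hu : M.MemScale γ (M.coef u)) :
    ∃ C : ℝ≥0, ∀ {Λ n : ℝ}, 0 < Λ → 0 < n →
      ∫⁻ ω, M.scaleNorm ((1 - θ) * (β - 2 * ℓ) + θ)
          (M.coef (M.posteriorMean β ℓ Λ (M.data u n (ξ ω)) - u)) ^ 2 ∂P ≤
        C * ENNReal.ofReal (Λ ^ (-(θ + s / (2 * ℓ - β + 1))) / n
          + Λ ^ (1 - θ + (γ - 1) / (2 * ℓ - β + 1))) := by
  obtain ⟨C, hC⟩ := hM.exists_scaleNorm_sub_sq_le ⟨hs, hs1⟩ hsΔ hγ hθ hu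
  obtain ⟨E, hE⟩ : ∃ E : ℝ≥0, ∫⁻ ω, M.scaleNorm (β - s) (ξ ω) ^ 2 ∂P = E :=
    ⟨_, (ENNReal.coe_toNNReal (hM.lintegral_scaleNorm_noise_sq_lt_top hξ hs hs').ne).symm⟩
  refine ⟨C * max E 1, fun {Λ n} hΛ hn => ?_⟩
  set v := Λ ^ (-(θ + s / (2 * ℓ - β + 1)))
  set b := Λ ^ (1 - θ + (γ - 1) / (2 * ℓ - β + 1))
  have h_pathwise : ∀ᵐ ω ∂P, M.scaleNorm ((1 - θ) * (β - 2 * ℓ) + θ)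
      (M.coef (M.posteriorMean β ℓ Λ (M.data u n (ξ ω)) - u)) ^ 2 ≤
      C * (ENNReal.ofReal (v / n) * M.scaleNorm (β - s) (ξ ω) ^ 2 + ENNReal.ofReal b) := by
    filter_upwards [hM.ae_memScale_data hξ hs hs' (hu.mono hγ.1) n] with ω hω
    refine (hC hΛ hω (hM.isPosteriorMean_posteriorMean hΛ (hω.mono (by linarith)))).trans_eq ?_
    rw [data_sub_coef, scaleNorm_smul, mul_pow, ← mul_assoc, ← enorm_pow, inv_pow,
      Real.sq_sqrt hn.le, Real.enorm_of_nonneg (by positivity),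
      ← ENNReal.ofReal_mul (by positivity), ← div_eq_mul_inv]
  calc _ ≤ _ := lintegral_mono_ae h_pathwise
    _ = C * (ENNReal.ofReal (v / n) * E + ENNReal.ofReal b) := by
        rw [lintegral_const_mul' _ _ ENNReal.coe_ne_top, lintegral_add_right _ measurable_const,
          lintegral_const_mul' _ _ ENNReal.ofReal_ne_top, hE, lintegral_const, measure_univ,
          mul_one]
    _ ≤ C * (ENNReal.ofReal (v / n) * max E 1 + ENNReal.ofReal b * max E 1) := by
        gcongr
        · exact le_max_left _ _
        · exact le_mul_of_one_le_right' (by simp)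
    _ = _ := by
        rw [← add_mul, ← ENNReal.ofReal_add (by positivity) (by positivity)]
        push_cast
        ring

end Data

lemma meanErrorRate {Ω : Type*} [MeasurableSpace Ω] {P : Measure Ω} [IsProbabilityMeasure P]
    {ξ : Ω → ℕ → ℝ} (hξ : M.IsNoise P ξ) {Δ γ θ ε : ℝ} (hΔ : Δ = 2 * ℓ - β + 1)
    (hγ : γ ∈ Icc 1 (Δ + 1)) (hθ : θ ∈ Icc 0 1) (hε : 0 < ε) {u : X}
    (hu : M.MemScale γ (M.coef u)) :
    M.MeanErrorRate β ℓ P ξ u ((1 - θ) * (β - 2 * ℓ) + θ)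
      (fun n => n ^ (-((γ - 1 + s₀ + ε) / (2 * (Δ + γ - 1 + s₀ + ε)))))
      (fun n => n ^ (-((Δ + γ - 1 - θ * Δ) / (Δ + γ - 1 + s₀ + ε)))) := by
  obtain ⟨s, hs, hsΔ, h_ceil, hsε⟩ := hM.exists_noise_index hε
  obtain ⟨C, hC⟩ := hM.exists_lintegral_scaleNorm_sub_sq_le hξ hs.1 h_ceil hs.2 hsΔ (hΔ ▸ hγ) hθ hu
  have hΔ_pos : 0 < Δ := hΔ ▸ hM.Δ_pos
  rw [← hΔ] at hC hsΔ
  set G := Δ + γ - 1 + s₀ + ε with hG_def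
  have hG : 0 < G := by linarith [hγ.1, hM.s₀_nonneg]
  refine ⟨2 * C + 1, by positivity, fun n hn => ?_⟩
  have hn0 : 0 < n := zero_lt_one.trans_le hn
  have h_data : ∀ᵐ ω ∂P, M.MemScale (2 * β - 2 * ℓ - 1) (M.data u n (ξ ω)) := by
    filter_upwards [hM.ae_memScale_data hξ hs.1 h_ceil (hu.mono hγ.1) n] with ω hω
    exact hω.mono (by linarith)
  have h_meas (k : ℕ) : AEMeasurable (fun ω => M.data u n (ξ ω) k) P :=
    ((hξ.hasLaw k).aemeasurable.const_mul _).const_add _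
  beta_reduce
  rw [regularization_rpow_eq hn0 hG.ne', show G - (γ - 1 + s₀ + ε) = Δ by rw [hG_def]; ring]
  set Λ := n ^ (-(Δ / G))
  have hΛ : 0 < Λ := Real.rpow_pos_of_pos hn0 _
  refine ⟨h_data.mono fun ω hω => hM.existsUnique_isPosteriorMean hΛ hω,
    hM.aestronglyMeasurable_posteriorMean hΛ h_meas h_data, (hC hΛ hn0).trans ?_⟩
  rw [bias_rpow_eq hn0.le hΔ_pos.ne', ← ENNReal.ofReal_coe_nnreal,
    ← ENNReal.ofReal_mul C.coe_nonneg]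
  have h_variance := variance_rpow_le (θ := θ) hn hΔ_pos.ne' hG
    (show s ≤ G - (Δ + γ - 1) by linarith)
  refine ENNReal.ofReal_le_ofReal ?_
  set R := (Δ + γ - 1 - θ * Δ) / G
  calc C * (Λ ^ (-(θ + s / Δ)) / n + n ^ (-R))
      ≤ C * (n ^ (-R) + n ^ (-R)) := by gcongr
    _ ≤ (2 * C + 1) * n ^ (-R) := by linarith [Real.rpow_nonneg hn0.le (-R)]

end Assumptions

end InverseProblem

theorem theorem2p2 {X : Type*} [NormedAddCommGroup X] [InnerProductSpace ℝ X] [CompleteSpace X]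
    (M : InverseProblem X) (s₀ β ℓ Δ : ℝ) (hM : M.Assumptions s₀ β ℓ) (hΔ : Δ = 2 * ℓ - β + 1)
    {Ω : Type*} [MeasurableSpace Ω] (P : Measure Ω) [IsProbabilityMeasure P]
    (ξ : Ω → ℕ → ℝ) (hξ : M.IsNoise P ξ)
    (γ : ℝ) (hγ : 1 ≤ γ) (u : X) (hu : M.MemScale γ (M.coef u))
    (θ η : ℝ) (hθ : θ ∈ Icc (0 : ℝ) 1) (hη : η = (1 - θ) * (β - 2 * ℓ) + θ)
    (ε : ℝ) (hε : 0 < ε) :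
    (γ ∈ Ioc 1 (Δ + 1) →
      M.MeanErrorRate β ℓ P ξ u η
        (fun n => n ^ (-((γ - 1 + s₀ + ε) / (2 * (Δ + γ - 1 + s₀ + ε)))))
        (fun n => n ^ (-((Δ + γ - 1 - θ * Δ) / (Δ + γ - 1 + s₀ + ε))))) ∧
    (Δ + 1 < γ →
      M.MeanErrorRate β ℓ P ξ u η
        (fun n => n ^ (-((Δ + s₀ + ε) / (2 * (2 * Δ + s₀ + ε)))))
        (fun n => n ^ (-(((2 - θ) * Δ) / (2 * Δ + s₀ + ε))))) ∧
    (γ = 1 → θ < 1 →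
      M.MeanErrorRate β ℓ P ξ u η
        (fun n => n ^ (-((s₀ + ε) / (2 * (Δ + s₀ + ε)))))
        (fun n => n ^ (-(((1 - θ) * Δ) / (Δ + s₀ + ε))))) := by
  have hΔ_pos : 0 < Δ := hΔ ▸ hM.Δ_pos
  subst hη
  refine ⟨fun h => hM.meanErrorRate hξ hΔ ⟨hγ, h.2⟩ hθ hε hu, fun h => ?_, fun h _ => ?_⟩
  · have h_saturated := hM.meanErrorRate hξ hΔ (γ := Δ + 1) ⟨by linarith, le_rfl⟩ hθ hε
      (hu.mono h.le)
    rwa [show Δ + 1 - 1 + s₀ + ε = Δ + s₀ + ε by ring,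
      show Δ + (Δ + 1) - 1 + s₀ + ε = 2 * Δ + s₀ + ε by ring,
      show Δ + (Δ + 1) - 1 - θ * Δ = (2 - θ) * Δ by ring] at h_saturated
  · subst h
    have h_endpoint := hM.meanErrorRate hξ hΔ ⟨le_rfl, by linarith⟩ hθ hε hu
    rwa [show 1 - 1 + s₀ + ε = s₀ + ε by ring, show Δ + 1 - 1 + s₀ + ε = Δ + s₀ + ε by ring,
      show Δ + 1 - 1 - θ * Δ = (1 - θ) * Δ by ring] at h_endpoint
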